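/- Let $S$ be a Polish space with a compatible metric and let $T=\mathbb N_0$ or $T=[0,\infty)$. Let $D(S)$ be the space of càdlàg functions $T\to S$ (all functions if $T=\mathbb N_0$) with the Skorokhod topology and its Borel $\sigma$-field. For a space $E$ ($E=S$ or $E=D(S)$) let $E^{\mathbb N^2}$ be the space of arrays, with the product $\sigma$-field. For finite permutations $\pi_1,\pi_2$ of $\mathbb N$ (bijections fixing all but finitely many integers) and $y\in E^{\mathbb N^2}$ put $y^{(\pi_1,\pi_2)}_{ij}=y_{\pi_1(i)\pi_2(j)}$. A random array $Y$ is exchangeable if $Y^{(\pi_1,\pi_2)}$ and $Y$ have the same law for all such $\pi_1,\pi_2$. Let $\mathcal E_E$ be the $\sigma$-field of measurable sets $A\subset E^{\mathbb N^2}$ with $\{y^{(\pi_1,\pi_2)}:y\in A\}=A$ for all such $\pi_1,\pi_2$, and for a random array $Y$ put $\mathcal E_Y=\{Y^{-1}(A):A\in\mathcal E_E\}$. For $y\in S^{\mathbb N^2}$ and $m\ge n$ let $t^{y,n}_m=\big(m(m-1)\cdots(m-n+1)\big)^{-2}\sum_{\psi_1,\psi_2}\delta_{(y_{\psi_1(i)\psi_2(j)})_{i,j\le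 n}}$, where the sum is over all injections $\psi_1,\psi_2:\{1,\dots,n\}\to\{1,\dots,m\}$. If for every $n$ the weak limit $\lim_{m\to\infty}t^{y,n}_m$ exists, let $|y|$ be the probability measure on $S^{\mathbb N^2}$ whose image under $z\mapsto(z_{ij})_{i,j\le n}$ is this limit for every $n$, provided that this measure is the law of an exchangeable array $Y$ that is dissociated, i.e. such that $(Y_{ij})_{i,j\le n}$ and $(Y_{ij})_{i,j>n}$ are independent for every $n$. In all other cases let $|y|=\partial$, an extra symbol that is not a measure. Let $X$ be an exchangeable process on a probability space $(\Omega,\mathcal A,P)$ with values in $S^{\mathbb N^2}$ and càdlàg paths, i.e. an exchangeable $D(S)$-valued random array, and let $t\in T$. Let $X(t)$ be the array of its values at time $t$ and $\phi_t:D(S)^{\mathbb N^2}\to S^{\mathbb N^2}$, $\phi_t(x)=x(t)$. Then: (a) $\mathcal E_{X(t)}\subset\mathcal E_X$. (b) If $\alpha^X$ is a regular conditional distribution of $X$ given $\mathcal E_X$, then for $P$-almost every $\omega$ the image $\alpha^X(\omega)\circ\phi_t^{-1}$ of the measure $\alpha^X(\omega)$ under $\phi_t$ equals $|X(t)(\omega)|$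 (in particular $|X(t)(\omega)|\neq\partial$). -/

import Mathlib

open MeasureTheory ProbabilityTheory Filter Topology
open scoped NNReal ENNReal

/-- Two-dimensional infinite arrays with entries in `S`, with the product topology and the
product σ-field. -/
abbrev Arr (S : Type*) : Type _ := ℕ → ℕ → S

/-- A permutation of `ℕ` that fixes all but finitely many values. -/
def IsFinPerm (π : Equiv.Perm ℕ) : Prop := {i | π i ≠ i}.Finite

namespace Arr

/-- The array `y^(π₁,π₂)` with entries `y (π₁ i) (π₂ j)`. -/
def permute {S : Type*} (π₁ π₂ : Equiv.Perm ℕ) (y : Arr S) : Arr S :=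
  fun i j => y (π₁ i) (π₂ j)

theorem permute_bijective {S : Type*} (π₁ π₂ : Equiv.Perm ℕ) :
    Function.Bijective (permute (S := S) π₁ π₂) := by
  refine Function.bijective_iff_has_inverse.2 ⟨permute π₁.symm π₂.symm, fun y => ?_, fun y => ?_⟩ <;>
    (funext i j; simp [permute])

/-- An array of random variables is exchangeable if its law is invariant under all pairs of finite
permutations of the rows and of the columns. -/
def IsExchangeable {S Ω : Type*} [MeasurableSpace S] [MeasurableSpace Ω] (Y : Ω → Arr S)
    (P : Measure Ω) : Prop :=
  ∀ π₁ π₂ : Equiv.Perm ℕ, IsFinPerm π₁ → IsFinPerm π₂ →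
    P.map (fun ω => permute π₁ π₂ (Y ω)) = P.map Y

/-- The exchangeable σ-field on the space of arrays: measurable sets `A` with `A^π = A` for all
pairs `π` of finite permutations. -/
@[reducible] def exchangeableSets (S : Type*) [MeasurableSpace S] : MeasurableSpace (Arr S) where
  MeasurableSet' A := MeasurableSet A ∧
    ∀ π₁ π₂ : Equiv.Perm ℕ, IsFinPerm π₁ → IsFinPerm π₂ → permute π₁ π₂ '' A = A
  measurableSet_empty := ⟨MeasurableSet.empty, fun _ _ _ _ => Set.image_empty _⟩
  measurableSet_compl A hA := ⟨hA.1.compl, fun π₁ π₂ h₁ h₂ => by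
    rw [Set.image_compl_eq (permute_bijective π₁ π₂), hA.2 π₁ π₂ h₁ h₂]⟩
  measurableSet_iUnion A hA := ⟨MeasurableSet.iUnion fun n => (hA n).1, fun π₁ π₂ h₁ h₂ => by
    rw [Set.image_iUnion]
    exact Set.iUnion_congr fun n => (hA n).2 π₁ π₂ h₁ h₂⟩

/-- The exchangeable σ-field of a random array `Y`: all events `Y⁻¹(A)` with `A` in the
exchangeable σ-field on the space of arrays. -/
@[reducible] def exchangeableField {S Ω : Type*} [MeasurableSpace S] (Y : Ω → Arr S) : MeasurableSpace Ω :=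
  (exchangeableSets S).comap Y

/-- Restriction of an array to the first `n` rows and columns. -/
def restrict {S : Type*} (n : ℕ) (y : Arr S) : Fin n → Fin n → S := fun i j => y i j

/-- A law on arrays is dissociated if, for each `n`, the entries with both indices among the first
`n` are independent of the entries with both indices beyond the first `n`. -/
def IsDissociated {S : Type*} [MeasurableSpace S] (ν : Measure (Arr S)) : Prop :=
  ∀ n : ℕ, IndepFun (restrict (S := S) n) (fun (y : Arr S) (i j : ℕ) => y (n + i) (n + j)) ν

/-- The set of laws of dissociated exchangeable arrays. -/
def dissociatedLaws (S : Type*) [MeasurableSpace S] : Set (ProbabilityMeasure (Arr S)) :=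
  {ν | IsExchangeable id (ν : Measure (Arr S)) ∧ IsDissociated (ν : Measure (Arr S))}

/-- The empirical distribution of `n × n` sub-arrays of the array `y` restricted to its first `m`
rows and columns; it is a probability measure for `m ≥ n` (and zero for `m < n`). -/
noncomputable def empirical {S : Type*} [MeasurableSpace S] (y : Arr S) (n m : ℕ) :
    FiniteMeasure (Fin n → Fin n → S) :=
  (((m.descFactorial n : ℝ≥0) ^ 2)⁻¹ : ℝ≥0) •
    ∑ ψ₁ : Fin n ↪ Fin m, ∑ ψ₂ : Fin n ↪ Fin m,
      (diracProba (fun i j : Fin n => y (ψ₁ i) (ψ₂ j))).toFiniteMeasure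

/-- For every `n`, the empirical distributions of `n × n` sub-arrays of `y` converge weakly, and
the limit is the restriction of `ν` to the first `n` rows and columns. -/
def HasLimitLaw {S : Type*} [TopologicalSpace S] [PolishSpace S] [MeasurableSpace S] [BorelSpace S]
    (y : Arr S) (ν : ProbabilityMeasure (Arr S)) : Prop :=
  ∀ n : ℕ, Tendsto (fun m => empirical y n m) atTop
    (𝓝 (ν.toFiniteMeasure.map (restrict n)))

open Classical in
/-- The projection `|y|`: the probability measure on arrays whose restrictions are the limits of the
empirical distributions of sub-arrays of `y`, if these limits exist and the measure is the law
of a dissociated exchangeable array; otherwise `none`, which plays the role of the extra point. -/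
noncomputable def proj {S : Type*} [TopologicalSpace S] [PolishSpace S] [MeasurableSpace S]
    [BorelSpace S] (y : Arr S) : Option (ProbabilityMeasure (Arr S)) :=
  if h : ∃ ν ∈ dissociatedLaws S, HasLimitLaw y ν then some h.choose else none

end Arr

/-- Right-continuous functions with left limits on a set `T` of times. On a discrete set of times
all functions have this property. -/
structure CadlagPath (T : Set ℝ) (S : Type*) [TopologicalSpace S] where
  /-- the underlying function -/
  toFun : T → S
  right_continuous : ∀ t : T, ContinuousWithinAt toFun (Set.Ici t) t
  left_limits : ∀ t : T, ∃ l : S, Tendsto toFun (𝓝[<] t) (𝓝 l)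

namespace CadlagPath

/-- Basic neighbourhood of `x` in the Skorokhod topology: paths that are `ε`-close to `x` up to
time `N` after an increasing bijective change of time that is `ε`-close to the identity up to
time `N`. -/
def skorokhodNhd {T : Set ℝ} {S : Type*} [MetricSpace S] (x : CadlagPath T S) (N ε : ℝ) :
    Set (CadlagPath T S) :=
  {y | ∃ l : T ≃o T, ∀ t : T, (t : ℝ) ≤ N →
    dist (l t) t < ε ∧ dist (y.toFun (l t)) (x.toFun t) < ε}

/-- The Skorokhod (`J₁`) topology on the space of càdlàg paths. On `[0,∞)`, it is the topology in
which `xₙ → x` iff for every `N` there are time changes `lₙ` with `sup_{t ≤ N} |lₙ(t) - t| → 0` and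
`sup_{t ≤ N} d(xₙ(lₙ(t)), x(t)) → 0`. On `{0, 1, 2, …}`, where the identity is the only time
change, it is the product topology. -/
instance skorokhodTopology {T : Set ℝ} {S : Type*} [MetricSpace S] :
    TopologicalSpace (CadlagPath T S) where
  IsOpen U := ∀ x ∈ U, ∃ N ε : ℝ, 0 < ε ∧ skorokhodNhd x N ε ⊆ U
  isOpen_univ _ _ := ⟨0, 1, one_pos, Set.subset_univ _⟩
  isOpen_inter U V hU hV x hx := by
    obtain ⟨N, ε, hε, h⟩ := hU x hx.1
    obtain ⟨M, δ, hδ, h'⟩ := hV x hx.2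
    refine ⟨max N M, min ε δ, lt_min hε hδ, fun y ⟨l, hl⟩ => ⟨h ⟨l, fun t ht => ?_⟩,
      h' ⟨l, fun t ht => ?_⟩⟩⟩
    · have := hl t (ht.trans (le_max_left _ _))
      exact ⟨this.1.trans_le (min_le_left _ _), this.2.trans_le (min_le_left _ _)⟩
    · have := hl t (ht.trans (le_max_right _ _))
      exact ⟨this.1.trans_le (min_le_right _ _), this.2.trans_le (min_le_right _ _)⟩
  isOpen_sUnion 𝒰 h𝒰 x hx := by
    obtain ⟨U, hU, hxU⟩ := hx
    obtain ⟨N, ε, hε, h⟩ := h𝒰 U hU x hxU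
    exact ⟨N, ε, hε, h.trans (Set.subset_sUnion_of_mem hU)⟩

/-- The Borel σ-field of the Skorokhod topology. -/
instance borelMeasurableSpace {T : Set ℝ} {S : Type*} [MetricSpace S] :
    MeasurableSpace (CadlagPath T S) :=
  borel (CadlagPath T S)

instance borelSpace {T : Set ℝ} {S : Type*} [MetricSpace S] : BorelSpace (CadlagPath T S) := ⟨rfl⟩

/-- The array of the values at time `t` of an array of càdlàg paths. -/
def evalArr {T : Set ℝ} {S : Type*} [TopologicalSpace S] (t : T) (x : Arr (CadlagPath T S)) :
    Arr S :=
  fun i j => (x i j).toFun t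

end CadlagPath

/-- `α` is a regular conditional distribution of the random element `Y` given the σ-field `m`: a
probability kernel from `(Ω, m)` such that `α(·, A)` is a version of the conditional
probability of `Y ∈ A` given `m`. -/
def IsRegCondDistrib {Ω E : Type*} {m : MeasurableSpace Ω} [mΩ : MeasurableSpace Ω]
    [MeasurableSpace E] (α : @Kernel Ω E m _) (Y : Ω → E) (P : Measure Ω) : Prop :=
  (∀ ω, IsProbabilityMeasure (α ω)) ∧
    ∀ A : Set E, MeasurableSet A → ∀ C : Set Ω, MeasurableSet[m] C →
      ∫⁻ ω in C, α ω A ∂P = P (C ∩ Y ⁻¹' A)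

/-! The mechanism is a law of large numbers for block frequencies. For a measurable set `B` of
finite blocks, `blockFreq` averages the indicator of `B` over all pairs of index tuples in a box,
repetitions allowed. Tuples with repetitions have proportion O(1/m) in a box of side m, so they are
negligible, and allowing them makes the frequency of a product event exactly the product of the
frequencies (`blockFreq_mul`). For an exchangeable array this factorization turns second moments of
frequencies into block probabilities up to O(1/k), so the frequencies are Cauchy in L² at a rate.
They converge almost surely along fourth powers, and a monotonicity argument fills the gaps. Their
limsup is invariant under finite permutations and has the right integrals over exchangeable events.
Hence it is the conditional probability of the block event (`IsExchangeable.ae_tendsto_blockFreq`).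
This is applied to the array of paths, with `B` pulled back through evaluation at time `t`, which is
Borel on the Skorokhod space. The frequencies of the observed array of values thus determine the
finite block laws of the image of the conditional distribution given the exchangeable field of the
whole paths. These laws do not depend on the chosen distinct indices, which gives exchangeability,
and factorization of frequencies gives dissociation. A countable algebra of sets reduces everything
to one null set. Part (a) holds because evaluation is measurable and commutes with permutations. -/

namespace CadlagPath

/-! ### Measurability of evaluation at a fixed time -/

/-- The paths that visit an open set during an open interval of times form a Skorokhod-open set. -/
theorem isOpen_visits {T : Set ℝ} {S : Type*} [MetricSpace S] {G : Set S} (hG : IsOpen G)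
    (a b : ℝ) :
    IsOpen {x : CadlagPath T S | ∃ s : T, a < s ∧ (s : ℝ) < b ∧ x.toFun s ∈ G} := by
  rintro x ⟨s, has, hsb, hs⟩
  obtain ⟨ε, hε, hball⟩ := Metric.isOpen_iff.1 hG _ hs
  refine ⟨s, min ε (min (s - a) (b - s)),
    lt_min hε (lt_min (sub_pos.2 has) (sub_pos.2 hsb)), ?_⟩
  rintro y ⟨l, hl⟩
  obtain ⟨h1, h2⟩ := hl s le_rfl
  have h3 : |((l s : T) : ℝ) - s| < min (s - a) (b - s) := h1.trans_le (min_le_right _ _)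
  rw [abs_lt] at h3
  have h4 := min_le_left ((s : ℝ) - a) (b - s)
  have h5 := min_le_right ((s : ℝ) - a) (b - s)
  exact ⟨l s, by linarith, by linarith, hball (h2.trans_le (min_le_left _ _))⟩

/-- Evaluation need not be Skorokhod-continuous, but by right continuity a path is in the closed set
`F` at time `t` iff, for each `k`, it visits the `1/(k+1)`-thickening of `F` strictly between `t`
and `t + 1/(k+1)`. Each of these conditions is open. -/
theorem measurable_eval_Ici {S : Type*} [MetricSpace S] [MeasurableSpace S] [BorelSpace S]
    (t : Set.Ici (0 : ℝ)) :
    Measurable (fun x : CadlagPath (Set.Ici (0 : ℝ)) S => x.toFun t) := by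
  refine measurable_of_isClosed fun F hF => ?_
  have key : (fun x : CadlagPath (Set.Ici (0 : ℝ)) S => x.toFun t) ⁻¹' F =
      ⋂ k : ℕ, {x | ∃ s : Set.Ici (0 : ℝ), (t : ℝ) < s ∧ (s : ℝ) < t + 1 / ((k : ℝ) + 1) ∧
        x.toFun s ∈ Metric.thickening (1 / ((k : ℝ) + 1)) F} := by
    ext x
    simp only [Set.mem_preimage, Set.mem_iInter, Set.mem_ofPred_eq]
    constructor
    · intro hx k
      have hk : (0 : ℝ) < 1 / ((k : ℝ) + 1) := Nat.one_div_pos_of_nat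
      have hmem : Metric.thickening (1 / ((k : ℝ) + 1)) F ∈ 𝓝 (x.toFun t) :=
        Metric.isOpen_thickening.mem_nhds (Metric.self_subset_thickening hk F hx)
      obtain ⟨δ, hδ, hsub⟩ := Metric.mem_nhdsWithin_iff.1 (x.right_continuous t hmem)
      have hm : 0 < min δ (1 / ((k : ℝ) + 1)) := lt_min hδ hk
      have h1 := min_le_left δ (1 / ((k : ℝ) + 1))
      have h2 := min_le_right δ (1 / ((k : ℝ) + 1))
      have ht : (0 : ℝ) ≤ t := t.2
      refine ⟨⟨t + min δ (1 / ((k : ℝ) + 1)) / 2, Set.mem_Ici.2 (by linarith)⟩, ?_, ?_,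
        hsub ⟨?_, ?_⟩⟩
      · dsimp; linarith
      · dsimp; linarith
      · rw [Metric.mem_ball, Subtype.dist_eq, Real.dist_eq, add_sub_cancel_left, abs_of_pos] <;>
          linarith
      · change (t : ℝ) ≤ _
        dsimp; linarith
    · intro h
      choose s hts hst hs using h
      have hne : F.Nonempty := by
        obtain ⟨z, hz, -⟩ := Metric.mem_thickening_iff.1 (hs 0)
        exact ⟨z, hz⟩
      rw [hF.mem_iff_infDist_zero hne]
      have hlim : Tendsto (fun k : ℕ => 1 / ((k : ℝ) + 1)) atTop (𝓝 0) :=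
        tendsto_one_div_add_atTop_nhds_zero_nat
      have hst' : Tendsto s atTop (𝓝[≥] t) := by
        refine tendsto_nhdsWithin_iff.2 ⟨?_, Eventually.of_forall fun k => (hts k).le⟩
        rw [tendsto_subtype_rng]
        refine tendsto_of_tendsto_of_tendsto_of_le_of_le tendsto_const_nhds ?_
          (fun k => (hts k).le) (fun k => (hst k).le)
        simpa using hlim.const_add (t : ℝ)
      have h1 : Tendsto (fun k => Metric.infDist (x.toFun (s k)) F) atTop
          (𝓝 (Metric.infDist (x.toFun t) F)) :=
        ((Metric.continuous_infDist_pt F).tendsto _).comp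
          (Tendsto.comp (x.right_continuous t) hst')
      refine tendsto_nhds_unique h1 (squeeze_zero (fun k => Metric.infDist_nonneg) (fun k => ?_) hlim)
      obtain ⟨z, hz, hd⟩ := Metric.mem_thickening_iff.1 (hs k)
      exact (Metric.infDist_le_dist_of_mem hz).trans hd.le
  rw [key]
  exact MeasurableSet.iInter fun k => (isOpen_visits Metric.isOpen_thickening _ _).measurableSet

/-- A time change moving an integer time by less than 1 to an integer time fixes it, so Skorokhod
closeness up to `t` gives closeness of the values at `t`. -/
theorem continuous_eval_natCast {S : Type*} [MetricSpace S]
    (t : Set.range (fun n : ℕ => (n : ℝ))) :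
    Continuous (fun x : CadlagPath (Set.range (fun n : ℕ => (n : ℝ))) S => x.toFun t) := by
  refine ⟨fun V hV x hx => ?_⟩
  obtain ⟨ε, hε, hball⟩ := Metric.isOpen_iff.1 hV _ hx
  refine ⟨t, min ε 1, lt_min hε one_pos, ?_⟩
  rintro y ⟨l, hl⟩
  obtain ⟨h1, h2⟩ := hl t le_rfl
  have h3 : l t = t := by
    obtain ⟨p, hp⟩ := (l t).2
    obtain ⟨q, hq⟩ := t.2
    have h4 : |((l t : _) : ℝ) - t| < 1 := h1.trans_le (min_le_right _ _)
    dsimp only at hp hq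
    rw [← hp, ← hq] at h4
    have h5 : |(p : ℤ) - q| < 1 := by exact_mod_cast h4
    rw [Int.abs_lt_one_iff, sub_eq_zero] at h5
    apply Subtype.ext
    rw [← hp, ← hq]
    exact_mod_cast h5
  rw [h3] at h2
  exact hball (h2.trans_le (min_le_left _ _))

theorem measurable_eval {S : Type*} [MetricSpace S] [MeasurableSpace S] [BorelSpace S]
    {T : Set ℝ} (hT : T = Set.range (fun n : ℕ => (n : ℝ)) ∨ T = Set.Ici 0) (t : T) :
    Measurable (fun x : CadlagPath T S => x.toFun t) := by
  rcases hT with rfl | rfl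
  · exact (continuous_eval_natCast t).measurable
  · exact measurable_eval_Ici t

end CadlagPath

/-! ### Finite permutations -/

namespace IsFinPerm

theorem one : IsFinPerm 1 := by simp [IsFinPerm]

theorem mul {π ρ : Equiv.Perm ℕ} (hπ : IsFinPerm π) (hρ : IsFinPerm ρ) : IsFinPerm (π * ρ) := by
  refine (hπ.union hρ).subset fun i hi => ?_
  by_contra h
  simp only [Set.mem_union, Set.mem_ofPred_eq, not_or, not_not] at h
  exact hi (by simp [h.2, h.1])

theorem symm {π : Equiv.Perm ℕ} (hπ : IsFinPerm π) : IsFinPerm π.symm := by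
  refine hπ.subset fun i hi h => hi ?_
  rw [Equiv.symm_apply_eq, h]

theorem swap (a b : ℕ) : IsFinPerm (Equiv.swap a b) := by
  refine (Set.toFinite {a, b}).subset fun i hi => ?_
  by_contra h
  simp only [Set.mem_insert_iff, Set.mem_singleton_iff, not_or] at h
  exact hi (Equiv.swap_apply_of_ne_of_ne h.1 h.2)

/-- A finite permutation preserves every sufficiently long initial segment of `ℕ`. -/
theorem eventually_lt_iff {π : Equiv.Perm ℕ} (hπ : IsFinPerm π) :
    ∀ᶠ m in atTop, ∀ i, π i < m ↔ i < m := by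
  obtain ⟨M, hM⟩ := hπ.bddAbove
  refine eventually_atTop.2 ⟨M + 1, fun m hm i => ?_⟩
  have hfix : ∀ j, M < j → π j = j := fun j hj => by
    by_contra h
    exact absurd (hM h) (by omega)
  constructor
  · intro h
    by_contra h'
    rw [hfix i (by omega)] at h
    exact h' h
  · intro h
    by_contra h'
    -- The value `π i` is beyond the support, hence fixed by `π`; injectivity then makes `i` itself
    -- fixed.
    have h2 : π i = i := π.injective (hfix (π i) (by omega))
    omega

/-- Any injection of a finite set into `ℕ` is transported to any other one by a finite
permutation. -/
theorem exists_comp_eq {ι : Type*} [Finite ι] {ψ χ : ι → ℕ} (hψ : Function.Injective ψ)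
    (hχ : Function.Injective χ) : ∃ π : Equiv.Perm ℕ, IsFinPerm π ∧ ∀ i, π (ψ i) = χ i := by
  classical
  have := Fintype.ofFinite ι
  suffices h : ∀ s : Finset ι, ∃ π : Equiv.Perm ℕ, IsFinPerm π ∧ ∀ i ∈ s, π (ψ i) = χ i by
    obtain ⟨π, hπ, h⟩ := h Finset.univ
    exact ⟨π, hπ, fun i => h i (Finset.mem_univ i)⟩
  intro s
  induction s using Finset.induction_on with
  | empty => exact ⟨1, one, by simp⟩
  | insert a s ha ih =>
    obtain ⟨π, hπ, h⟩ := ih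
    -- The transposition corrects the value at `ψ a`. It leaves the earlier values alone because `ψ`
    -- and `χ` are injective.
    refine ⟨Equiv.swap (π (ψ a)) (χ a) * π, (swap _ _).mul hπ, fun i hi => ?_⟩
    rcases Finset.mem_insert.1 hi with rfl | hi
    · simp
    · have hne : i ≠ a := fun h => ha (h ▸ hi)
      rw [Equiv.Perm.mul_apply, Equiv.swap_apply_of_ne_of_ne, h i hi]
      · exact fun h' => hne (hψ (π.injective h'))
      · rw [h i hi]
        exact fun h' => hne (hχ h')

end IsFinPerm

/-! ### Index tuples with repetitions are rare -/

/-- The number of non-injective functions in a finite product of initial segments of `ℕ`, all of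
length at least `k`. -/
theorem card_filter_not_injective_le {ι : Type*} [Fintype ι] [DecidableEq ι] (N : ι → ℕ) {k : ℕ}
    (hk : ∀ i, k ≤ N i) :
    k * ((Fintype.piFinset fun i => Finset.range (N i)).filter
      fun p => ¬ Function.Injective p).card ≤ Fintype.card ι ^ 2 * ∏ i, N i := by
  classical
  set Q := Fintype.piFinset fun i => Finset.range (N i)
  have hpair : ∀ i j : ι, i ≠ j → k * (Q.filter fun p => p i = p j).card ≤ ∏ l, N l := by
    intro i j hij
    rcases Nat.eq_zero_or_pos k with rfl | hk0
    · simp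
    have h1 : (Q.filter fun p => p i = p j).card ≤
        (Fintype.piFinset fun l => Finset.range (Function.update N j 1 l)).card := by
      -- Erasing coordinate `j` loses nothing on tuples with `p i = p j`, so they number at most the
      -- points of a box whose side `j` has length 1.
      refine Finset.card_le_card_of_injOn (fun p => Function.update p j 0) ?_ ?_
      · intro p hp
        simp only [Q, Finset.coe_filter, Fintype.mem_piFinset, Finset.mem_range,
          Set.mem_ofPred_eq] at hp
        simp only [Finset.mem_coe, Fintype.mem_piFinset, Finset.mem_range]
        intro l
        by_cases hl : l = j
        · subst hl; simp
        · simpa [hl] using hp.1 l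
      · intro p hp q hq h
        simp only [Q, Finset.coe_filter, Set.mem_ofPred_eq] at hp hq
        have hl : ∀ l, l ≠ j → p l = q l := fun l hl => by
          simpa [hl] using congrFun h l
        funext l
        by_cases hlj : l = j
        · rw [hlj, ← hp.2, ← hq.2, hl i hij]
        · exact hl l hlj
    have h2 : (Fintype.piFinset fun l => Finset.range (Function.update N j 1 l)).card * N j =
        ∏ l, N l := by
      simp only [Fintype.card_piFinset, Finset.card_range]
      rw [Finset.prod_update_of_mem (Finset.mem_univ j), one_mul, mul_comm,
        ← Finset.mul_prod_erase _ _ (Finset.mem_univ j), Finset.sdiff_singleton_eq_erase]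
    calc k * (Q.filter fun p => p i = p j).card
        ≤ N j * (Fintype.piFinset fun l => Finset.range (Function.update N j 1 l)).card :=
          Nat.mul_le_mul (hk j) h1
      _ = _ := by rw [mul_comm, h2]
  have hsub : Q.filter (fun p => ¬ Function.Injective p) ⊆
      ((Finset.univ : Finset (ι × ι)).filter fun e => e.1 ≠ e.2).biUnion
        fun e => Q.filter fun p => p e.1 = p e.2 := by
    intro p hp
    simp only [Finset.mem_filter, Function.Injective, not_forall] at hp
    obtain ⟨hpQ, i, j, hpij, hij⟩ := hp
    simp only [Finset.mem_biUnion, Finset.mem_filter, Finset.mem_univ, true_and]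
    exact ⟨(i, j), hij, hpQ, hpij⟩
  calc k * (Q.filter fun p => ¬ Function.Injective p).card
      ≤ k * ∑ e ∈ (Finset.univ : Finset (ι × ι)).filter fun e => e.1 ≠ e.2,
          (Q.filter fun p => p e.1 = p e.2).card :=
        Nat.mul_le_mul_left _ ((Finset.card_le_card hsub).trans Finset.card_biUnion_le)
    _ ≤ ∑ e ∈ (Finset.univ : Finset (ι × ι)).filter fun e => e.1 ≠ e.2, ∏ l, N l := by
        rw [Finset.mul_sum]
        exact Finset.sum_le_sum fun e he => hpair _ _ (Finset.mem_filter.1 he).2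
    _ ≤ Fintype.card ι ^ 2 * ∏ i, N i := by
        rw [Finset.sum_const, smul_eq_mul]
        refine Nat.mul_le_mul_right _ ((Finset.card_filter_le _ _).trans ?_)
        simp [sq]

/-- A double average over a finite set is close to a constant `c` if it averages to `c` over a large
part of the set. -/
theorem abs_average_sub_le {α : Type*} (Q : Finset α) (p : α → Prop) [DecidablePred p]
    (g : α → α → ℝ) (c : ℝ) (hQ : Q.Nonempty)
    (hgood : ∑ a ∈ Q.filter p, ∑ b ∈ Q.filter p, (g a b - c) = 0)
    (hg : ∀ a b, |g a b - c| ≤ 1) :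
    |((Q.card : ℝ) ^ 2)⁻¹ * ∑ a ∈ Q, ∑ b ∈ Q, g a b - c| ≤
      2 * (Q.filter fun a => ¬ p a).card / Q.card := by
  have hq : (0 : ℝ) < Q.card := by exact_mod_cast hQ.card_pos
  have hbound : ∀ U V : Finset α, |∑ a ∈ U, ∑ b ∈ V, (g a b - c)| ≤ U.card * V.card := by
    intro U V
    calc |∑ a ∈ U, ∑ b ∈ V, (g a b - c)| ≤ ∑ a ∈ U, ∑ b ∈ V, |g a b - c| :=
          (Finset.abs_sum_le_sum_abs _ _).trans
            (Finset.sum_le_sum fun a _ => Finset.abs_sum_le_sum_abs _ _)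
      _ ≤ ∑ a ∈ U, ∑ b ∈ V, (1 : ℝ) :=
          Finset.sum_le_sum fun a _ => Finset.sum_le_sum fun b _ => hg a b
      _ = U.card * V.card := by simp
  -- The part where both indices satisfy `p` vanishes by `hgood`; the rest has at most `2 * |Q|`
  -- times the number of bad indices many terms.
  have hsplit : ∑ a ∈ Q, ∑ b ∈ Q, (g a b - c) =
      ∑ a ∈ Q.filter p, ∑ b ∈ Q.filter (fun b => ¬ p b), (g a b - c) +
        ∑ a ∈ Q.filter (fun a => ¬ p a), ∑ b ∈ Q, (g a b - c) := by
    rw [← Finset.sum_filter_add_sum_filter_not Q p fun a => ∑ b ∈ Q, (g a b - c)]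
    congr 1
    rw [← zero_add (∑ a ∈ Q.filter p, ∑ b ∈ Q.filter (fun b => ¬ p b), (g a b - c)), ← hgood,
      ← Finset.sum_add_distrib]
    exact Finset.sum_congr rfl fun a _ => (Finset.sum_filter_add_sum_filter_not Q p _).symm
  have heq : ((Q.card : ℝ) ^ 2)⁻¹ * ∑ a ∈ Q, ∑ b ∈ Q, g a b - c =
      ((Q.card : ℝ) ^ 2)⁻¹ * ∑ a ∈ Q, ∑ b ∈ Q, (g a b - c) := by
    simp only [Finset.sum_sub_distrib, Finset.sum_const, nsmul_eq_mul]
    field_simp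
  rw [heq, abs_mul, abs_of_pos (by positivity), inv_mul_le_iff₀ (by positivity), hsplit]
  have hle : ((Q.filter p).card : ℝ) ≤ Q.card := by exact_mod_cast Finset.card_filter_le _ _
  calc _ ≤ ((Q.filter p).card : ℝ) * (Q.filter fun a => ¬ p a).card +
        (Q.filter fun a => ¬ p a).card * Q.card :=
        (abs_add_le _ _).trans (add_le_add (hbound _ _) (hbound _ _))
    _ ≤ Q.card * (Q.filter fun a => ¬ p a).card + (Q.filter fun a => ¬ p a).card * Q.card := by
        gcongr
    _ = (Q.card : ℝ) ^ 2 * (2 * (Q.filter fun a => ¬ p a).card / Q.card) := by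
        field_simp; ring

/-- The product of the initial segments of `ℕ` of lengths `N i`. -/
def indexBox {ι : Type*} [Fintype ι] [DecidableEq ι] (N : ι → ℕ) : Finset (ι → ℕ) :=
  Fintype.piFinset fun i => Finset.range (N i)

section indexBox

variable {ι κ : Type*} [Fintype ι] [DecidableEq ι] [Fintype κ] [DecidableEq κ]

theorem mem_indexBox {N : ι → ℕ} {a : ι → ℕ} : a ∈ indexBox N ↔ ∀ i, a i < N i := by
  simp [indexBox]

theorem card_indexBox (N : ι → ℕ) : (indexBox N).card = ∏ i, N i := by
  simp [indexBox]

theorem indexBox_nonempty {N : ι → ℕ} {k : ℕ} (hk : 0 < k) (hN : ∀ i, k ≤ N i) :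
    (indexBox N).Nonempty :=
  ⟨0, mem_indexBox.2 fun i => hk.trans_le (hN i)⟩

theorem sum_indexBox_sumElim {M : Type*} [AddCommMonoid M] (N : ι → ℕ) (N' : κ → ℕ)
    (f : (ι ⊕ κ → ℕ) → M) :
    ∑ p ∈ indexBox (Sum.elim N N'), f p =
      ∑ a ∈ indexBox N, ∑ b ∈ indexBox N', f (Sum.elim a b) := by
  rw [← Finset.sum_product']
  refine Finset.sum_equiv (Equiv.sumArrowEquivProdArrow ι κ ℕ) ?_ ?_
  · intro p
    simp [mem_indexBox, Equiv.sumArrowEquivProdArrow]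
  · intro p _
    congr 1
    funext i
    cases i <;> rfl

theorem two_mul_card_not_injective_div_le {N : ι → ℕ} {k : ℕ} (hk : 0 < k) (hN : ∀ i, k ≤ N i) :
    2 * (((indexBox N).filter fun p => ¬ Function.Injective p).card : ℝ) / (indexBox N).card ≤
      2 * (Fintype.card ι : ℝ) ^ 2 / k := by
  have hcard := card_filter_not_injective_le N hN
  rw [← card_indexBox N] at hcard
  have hcard' : (k : ℝ) * ((indexBox N).filter fun p => ¬ Function.Injective p).card ≤
      (Fintype.card ι : ℝ) ^ 2 * (indexBox N).card := by
    exact_mod_cast hcard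
  have hq : (0 : ℝ) < (indexBox N).card := by exact_mod_cast (indexBox_nonempty hk hN).card_pos
  have hk' : (0 : ℝ) < k := by exact_mod_cast hk
  rw [div_le_div_iff₀ hq hk']
  linarith

end indexBox

/-! ### Block frequencies and exchangeability -/

namespace Arr

/-- The array with entries `x (a i) (b j)`. -/
def subarray {E ι : Type*} (a b : ι → ℕ) (x : Arr E) : ι → ι → E := fun i j => x (a i) (b j)

theorem measurable_subarray {E ι : Type*} [MeasurableSpace E] (a b : ι → ℕ) :
    Measurable (subarray (E := E) a b) := by
  unfold subarray; fun_prop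

theorem measurable_permute {E : Type*} [MeasurableSpace E] (π₁ π₂ : Equiv.Perm ℕ) :
    Measurable (permute (S := E) π₁ π₂) := by
  unfold permute; fun_prop

/-- The proportion of the subarrays of `x`, with row and column indices in `indexBox N`, that lie
in `B`. -/
noncomputable def blockFreq {E ι : Type*} [Fintype ι] [DecidableEq ι] (N : ι → ℕ)
    (B : Set (ι → ι → E)) (x : Arr E) : ℝ :=
  (((indexBox N).card : ℝ) ^ 2)⁻¹ *
    ∑ a ∈ indexBox N, ∑ b ∈ indexBox N, B.indicator (fun _ => (1 : ℝ)) (subarray a b x)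

/-- The arrays whose two diagonal blocks lie in `B` and in `B'`. -/
def blockProd {E ι κ : Type*} (B : Set (ι → ι → E)) (B' : Set (κ → κ → E)) :
    Set (ι ⊕ κ → ι ⊕ κ → E) :=
  {z | (fun i j => z (Sum.inl i) (Sum.inl j)) ∈ B ∧ (fun i j => z (Sum.inr i) (Sum.inr j)) ∈ B'}

section

variable {E ι κ : Type*} [Fintype ι] [DecidableEq ι] [Fintype κ] [DecidableEq κ]

theorem measurableSet_blockProd {ι κ : Type*} [MeasurableSpace E] {B : Set (ι → ι → E)}
    {B' : Set (κ → κ → E)} (hB : MeasurableSet B) (hB' : MeasurableSet B') :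
    MeasurableSet (blockProd B B') := by
  refine MeasurableSet.inter (?_ : MeasurableSet (_ ⁻¹' B)) (?_ : MeasurableSet (_ ⁻¹' B'))
  · exact hB.preimage (by fun_prop)
  · exact hB'.preimage (by fun_prop)

/-- A tuple in the joint box is an unconstrained pair of tuples, so the double sum factorizes
exactly. With injective tuples only, the two halves would be coupled. This identity drives both the
variance bound and dissociation. -/
theorem blockFreq_mul (N : ι → ℕ) (N' : κ → ℕ) (B : Set (ι → ι → E)) (B' : Set (κ → κ → E))
    (x : Arr E) :
    blockFreq (Sum.elim N N') (blockProd B B') x = blockFreq N B x * blockFreq N' B' x := by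
  have h : ∀ (a b : ι → ℕ) (a' b' : κ → ℕ),
      (blockProd B B').indicator (fun _ => (1 : ℝ)) (subarray (Sum.elim a a') (Sum.elim b b') x) =
        B.indicator (fun _ => (1 : ℝ)) (subarray a b x) *
          B'.indicator (fun _ => (1 : ℝ)) (subarray a' b' x) := by
    classical
    intro a b a' b'
    have : subarray (Sum.elim a a') (Sum.elim b b') x ∈ blockProd B B' ↔
        subarray a b x ∈ B ∧ subarray a' b' x ∈ B' := Iff.rfl
    simp only [Set.indicator_apply, this]
    by_cases h1 : subarray a b x ∈ B <;> by_cases h2 : subarray a' b' x ∈ B' <;> simp [h1, h2]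
  have hc : (indexBox (Sum.elim N N')).card = (indexBox N).card * (indexBox N').card := by
    simp [card_indexBox]
  unfold blockFreq
  rw [hc, Nat.cast_mul, mul_pow, mul_inv, mul_mul_mul_comm]
  congr 1
  simp only [sum_indexBox_sumElim, h, ← Finset.mul_sum, ← Finset.sum_mul]

theorem blockFreq_nonneg (N : ι → ℕ) (B : Set (ι → ι → E)) (x : Arr E) : 0 ≤ blockFreq N B x := by
  unfold blockFreq
  refine mul_nonneg (by positivity) (Finset.sum_nonneg fun a _ => Finset.sum_nonneg fun b _ => ?_)
  exact Set.indicator_nonneg (fun _ _ => zero_le_one) _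

theorem blockFreq_le_one (N : ι → ℕ) (B : Set (ι → ι → E)) (x : Arr E) : blockFreq N B x ≤ 1 := by
  unfold blockFreq
  calc _ ≤ (((indexBox N).card : ℝ) ^ 2)⁻¹ * ∑ a ∈ indexBox N, ∑ b ∈ indexBox N, (1 : ℝ) := by
        gcongr
        exact Set.indicator_le_self' (fun _ _ => zero_le_one) _
    _ ≤ 1 := by
        simp only [Finset.sum_const, nsmul_eq_mul, mul_one, ← sq]
        exact inv_mul_le_one

theorem measurable_blockFreq [MeasurableSpace E] (N : ι → ℕ) {B : Set (ι → ι → E)}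
    (hB : MeasurableSet B) : Measurable (blockFreq N B) := by
  unfold blockFreq
  refine Measurable.const_mul (Finset.measurable_sum _ fun a _ => Finset.measurable_sum _
    fun b _ => ?_) _
  exact (measurable_const.indicator hB).comp (measurable_subarray a b)

/-- Finite permutations of rows and columns do not change the frequencies over large boxes. -/
theorem eventually_blockFreq_permute {π₁ π₂ : Equiv.Perm ℕ} (h₁ : IsFinPerm π₁)
    (h₂ : IsFinPerm π₂) (B : Set (ι → ι → E)) (x : Arr E) :
    ∀ᶠ m : ℕ in atTop, blockFreq (fun _ => m) B (permute π₁ π₂ x) = blockFreq (fun _ => m) B x := by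
  filter_upwards [h₁.eventually_lt_iff, h₂.eventually_lt_iff] with m hm₁ hm₂
  unfold blockFreq
  congr 1
  have key : ∀ (π : Equiv.Perm ℕ) (_ : ∀ i, π i < m ↔ i < m) (f : (ι → ℕ) → ℝ),
      ∑ a ∈ indexBox (fun _ : ι => m), f (fun i => π (a i)) =
        ∑ a ∈ indexBox (fun _ : ι => m), f a := by
    intro π hπ f
    refine Finset.sum_equiv (Equiv.arrowCongr (Equiv.refl ι) π) ?_ ?_
    · intro a
      simp [mem_indexBox, hπ]
    · intro a _
      rfl
  rw [← key π₁ hm₁ fun a => ∑ b ∈ indexBox (fun _ : ι => m),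
    B.indicator (fun _ => (1 : ℝ)) (subarray a b x)]
  exact Finset.sum_congr rfl fun a _ => (key π₂ hm₂ fun b =>
    B.indicator (fun _ => (1 : ℝ)) (subarray (fun i => π₁ (a i)) b x))

/-- The event that a subarray lies in `B`, intersected with an event in the exchangeable σ-field,
has the same probability for all subarrays with distinct rows and distinct columns. -/
theorem IsExchangeable.measure_subarray {Ω ι : Type*} [Finite ι] [MeasurableSpace E]
    [MeasurableSpace Ω] {P : Measure Ω} {X : Ω → Arr E} (hX : Measurable X)
    (hexch : IsExchangeable X P) {a b a' b' : ι → ℕ} (ha : Function.Injective a)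
    (hb : Function.Injective b) (ha' : Function.Injective a') (hb' : Function.Injective b')
    {B : Set (ι → ι → E)} (hB : MeasurableSet B) {C : Set Ω}
    (hC : MeasurableSet[exchangeableField X] C) :
    P (C ∩ {ω | subarray a b (X ω) ∈ B}) = P (C ∩ {ω | subarray a' b' (X ω) ∈ B}) := by
  -- The permutations below carry `a'` to `a` and `b'` to `b`: the permuted array shows at `(a',
  -- b')` the block that `X` has at `(a, b)`, while `A` is invariant.
  obtain ⟨A, hA, rfl⟩ := hC
  obtain ⟨π₁, hπ₁, h₁⟩ := IsFinPerm.exists_comp_eq ha' ha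
  obtain ⟨π₂, hπ₂, h₂⟩ := IsFinPerm.exists_comp_eq hb' hb
  have hD : MeasurableSet (A ∩ subarray a' b' ⁻¹' B) :=
    hA.1.inter (hB.preimage (measurable_subarray a' b'))
  have h := congrArg (fun μ => μ (A ∩ subarray a' b' ⁻¹' B)) (hexch π₁ π₂ hπ₁ hπ₂)
  rw [Measure.map_apply (f := fun ω => permute π₁ π₂ (X ω))
    ((measurable_permute π₁ π₂).comp hX) hD, Measure.map_apply hX hD] at h
  refine (congrArg P ?_).trans h
  have hmem : ∀ x, permute π₁ π₂ x ∈ A ↔ x ∈ A := fun x => by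
    constructor
    · intro hx
      rw [← hA.2 π₁ π₂ hπ₁ hπ₂] at hx
      obtain ⟨y, hy, hyx⟩ := hx
      exact (permute_bijective π₁ π₂).1 hyx ▸ hy
    · intro hx
      rw [← hA.2 π₁ π₂ hπ₁ hπ₂]
      exact ⟨x, hx, rfl⟩
  ext ω
  have : subarray a' b' (permute π₁ π₂ (X ω)) = subarray a b (X ω) := by
    funext i j
    simp [subarray, permute, h₁, h₂]
  simp only [Set.mem_inter_iff, Set.mem_preimage, Set.mem_ofPred_eq, hmem, this]

theorem exchangeableField_le {Ω : Type*} [MeasurableSpace E] [MeasurableSpace Ω] {X : Ω → Arr E}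
    (hX : Measurable X) : exchangeableField X ≤ ‹MeasurableSpace Ω› := by
  rintro C ⟨A, hA, rfl⟩
  exact hA.1.preimage hX

theorem integrable_blockFreq {Ω : Type*} [MeasurableSpace E] [MeasurableSpace Ω] {P : Measure Ω}
    [IsFiniteMeasure P] {X : Ω → Arr E} (hX : Measurable X) (N : ι → ℕ) {B : Set (ι → ι → E)}
    (hB : MeasurableSet B) : Integrable (fun ω => blockFreq N B (X ω)) P :=
  Integrable.of_bound ((measurable_blockFreq N hB).comp hX).aestronglyMeasurable 1
    (Eventually.of_forall fun ω => by
      rw [Real.norm_of_nonneg (blockFreq_nonneg _ _ _)]; exact blockFreq_le_one _ _ _)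

/-- The expected frequency of `B` is close to the probability that a subarray with distinct rows and
distinct columns lies in `B`. -/
theorem IsExchangeable.abs_setIntegral_blockFreq_sub_le {Ω : Type*} [MeasurableSpace E]
    [MeasurableSpace Ω] {P : Measure Ω} [IsProbabilityMeasure P] {X : Ω → Arr E}
    (hX : Measurable X) (hexch : IsExchangeable X P) {N : ι → ℕ} {k : ℕ} (hk : 0 < k)
    (hN : ∀ i, k ≤ N i) {a b : ι → ℕ} (ha : Function.Injective a) (hb : Function.Injective b)
    {B : Set (ι → ι → E)} (hB : MeasurableSet B) {C : Set Ω}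
    (hC : MeasurableSet[exchangeableField X] C) :
    |∫ ω in C, blockFreq N B (X ω) ∂P - P.real (C ∩ {ω | subarray a b (X ω) ∈ B})| ≤
      2 * (Fintype.card ι : ℝ) ^ 2 / k := by
  classical
  have hCm : MeasurableSet C := exchangeableField_le hX _ hC
  have hmeas : ∀ a' b' : ι → ℕ, MeasurableSet {ω | subarray a' b' (X ω) ∈ B} := fun a' b' =>
    hB.preimage ((measurable_subarray a' b').comp hX)
  have hint : ∫ ω in C, blockFreq N B (X ω) ∂P = (((indexBox N).card : ℝ) ^ 2)⁻¹ *
      ∑ a' ∈ indexBox N, ∑ b' ∈ indexBox N,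
        P.real (C ∩ {ω | subarray a' b' (X ω) ∈ B}) := by
    have h1 : ∀ a' b' : ι → ℕ, (fun ω => B.indicator (fun _ => (1 : ℝ)) (subarray a' b' (X ω))) =
        {ω | subarray a' b' (X ω) ∈ B}.indicator (fun _ => (1 : ℝ)) := fun a' b' => rfl
    have h2 : ∀ a' b' : ι → ℕ, Integrable
        (fun ω => B.indicator (fun _ => (1 : ℝ)) (subarray a' b' (X ω))) (P.restrict C) := by
      intro a' b'
      rw [h1]
      exact (integrable_const _).indicator (hmeas a' b')
    unfold blockFreq
    rw [integral_const_mul, integral_finsetSum _ fun a' _ => integrable_finsetSum _ fun b' _ => h2 a' b']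
    congr 1
    refine Finset.sum_congr rfl fun a' _ => ?_
    rw [integral_finsetSum _ fun b' _ => h2 a' b']
    refine Finset.sum_congr rfl fun b' _ => ?_
    rw [h1, integral_indicator (hmeas a' b')]
    simp [Measure.real, Measure.restrict_apply (hmeas a' b'), Set.inter_comm]
  rw [hint]
  have hne := indexBox_nonempty hk hN
  -- All pairs of injective tuples contribute the same probability, so their deviations sum to
  -- exactly zero.
  refine (abs_average_sub_le (indexBox N) Function.Injective
    (fun a' b' => P.real (C ∩ {ω | subarray a' b' (X ω) ∈ B})) _ hne ?_ ?_).trans ?_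
  · refine Finset.sum_eq_zero fun a' ha' => Finset.sum_eq_zero fun b' hb' => ?_
    rw [sub_eq_zero, Measure.real, Measure.real, hexch.measure_subarray hX
      (Finset.mem_filter.1 ha').2 (Finset.mem_filter.1 hb').2 ha hb hB hC]
  · intro a' b'
    have h1 := measureReal_nonneg (μ := P) (s := C ∩ {ω | subarray a' b' (X ω) ∈ B})
    have h2 := measureReal_le_one (μ := P) (s := C ∩ {ω | subarray a' b' (X ω) ∈ B})
    have h3 := measureReal_nonneg (μ := P) (s := C ∩ {ω | subarray a b (X ω) ∈ B})
    have h4 := measureReal_le_one (μ := P) (s := C ∩ {ω | subarray a b (X ω) ∈ B})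
    rw [abs_le]
    constructor <;> linarith
  · exact two_mul_card_not_injective_div_le hk hN

end

end Arr

/-! ### Almost sure convergence of frequencies and identification of the limit -/

/-- A sequence that becomes monotone after multiplication by a power of the index converges if it
converges along the fourth powers. -/
theorem tendsto_of_tendsto_pow_four {s : ℕ → ℝ} {d : ℕ} {l : ℝ} (hs : ∀ m, 0 ≤ s m)
    (hmono : Monotone fun m : ℕ => (m : ℝ) ^ d * s m)
    (h : Tendsto (fun j : ℕ => s ((j + 1) ^ 4)) atTop (𝓝 l)) : Tendsto s atTop (𝓝 l) := by
  set r : ℕ → ℝ := fun j => (((j : ℝ) / (j + 1)) ^ 4) ^ d with hr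
  have hr1 : Tendsto r atTop (𝓝 1) := by
    simpa using ((tendsto_natCast_div_add_atTop (1 : ℝ)).pow 4).pow d
  have h0 : Tendsto (fun j : ℕ => s (j ^ 4)) atTop (𝓝 l) :=
    (tendsto_add_atTop_iff_nat (f := fun j : ℕ => s (j ^ 4)) 1).1 h
  have hup : Tendsto (fun j => (r j)⁻¹ * s ((j + 1) ^ 4)) atTop (𝓝 l) := by
    simpa using (hr1.inv₀ one_ne_zero).mul h
  have hlow : Tendsto (fun j => r j * s (j ^ 4)) atTop (𝓝 l) := by
    simpa using hr1.mul h0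
  have hsqrt : Tendsto Nat.sqrt atTop atTop := by
    refine tendsto_atTop.2 fun b => eventually_atTop.2 ⟨b * b, fun m hm => Nat.le_sqrt.2 hm⟩
  have hj : Tendsto (fun m => Nat.sqrt (Nat.sqrt m)) atTop atTop := hsqrt.comp hsqrt
  have hle : ∀ m : ℕ, Nat.sqrt (Nat.sqrt m) ^ 4 ≤ m := fun m => by
    calc Nat.sqrt (Nat.sqrt m) ^ 4 = (Nat.sqrt (Nat.sqrt m) ^ 2) ^ 2 := by ring
      _ ≤ Nat.sqrt m ^ 2 := Nat.pow_le_pow_left (Nat.sqrt_le' _) 2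
      _ ≤ m := Nat.sqrt_le' _
  have hlt : ∀ m : ℕ, m ≤ (Nat.sqrt (Nat.sqrt m) + 1) ^ 4 := fun m => by
    have h1 : Nat.sqrt m + 1 ≤ (Nat.sqrt (Nat.sqrt m) + 1) ^ 2 := Nat.lt_succ_sqrt' _
    calc m ≤ (Nat.sqrt m + 1) ^ 2 := (Nat.lt_succ_sqrt' _).le
      _ ≤ ((Nat.sqrt (Nat.sqrt m) + 1) ^ 2) ^ 2 := Nat.pow_le_pow_left h1 2
      _ = _ := by ring
  -- With `j` the integer part of the fourth root of `m`, one has `j ^ 4 ≤ m ≤ (j + 1) ^ 4`.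
  -- Monotonicity traps `s m` between the values at these ends, up to the ratio `r j → 1`.
  refine tendsto_of_tendsto_of_tendsto_of_le_of_le' (hlow.comp hj) (hup.comp hj) ?_ ?_
  all_goals
    filter_upwards [eventually_ge_atTop 1] with m hm
    have hj1 : 1 ≤ Nat.sqrt (Nat.sqrt m) := Nat.le_sqrt.2 (Nat.le_sqrt.2 (by simpa using hm))
    have hlem := hle m
    have hltm := hlt m
    have hm1 := hmono hlem
    have hm2 := hmono hltm
    simp only [Function.comp_apply, hr]
    generalize Nat.sqrt (Nat.sqrt m) = j at *
    have hj0 : (0 : ℝ) < j := by exact_mod_cast hj1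
    have hm0 : (0 : ℝ) < m := by exact_mod_cast hm
    have hle' : (j : ℝ) ^ 4 ≤ m := by exact_mod_cast hlem
    have hlt' : (m : ℝ) ≤ ((j : ℝ) + 1) ^ 4 := by exact_mod_cast hltm
    push_cast at hm1 hm2
    have e1 : ((j : ℝ) ^ 4) ^ d ≤ (m : ℝ) ^ d := by gcongr
    have e2 : (m : ℝ) ^ d ≤ (((j : ℝ) + 1) ^ 4) ^ d := by gcongr
    rw [div_pow, div_pow]
  · rw [div_mul_eq_mul_div, div_le_iff₀ (by positivity)]
    calc _ ≤ (m : ℝ) ^ d * s m := hm1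
      _ ≤ (((j : ℝ) + 1) ^ 4) ^ d * s m := mul_le_mul_of_nonneg_right e2 (hs m)
      _ = _ := mul_comm _ _
  · rw [inv_div, div_mul_eq_mul_div, le_div_iff₀ (by positivity)]
    calc s m * ((j : ℝ) ^ 4) ^ d ≤ s m * (m : ℝ) ^ d := mul_le_mul_of_nonneg_left e1 (hs m)
      _ = (m : ℝ) ^ d * s m := mul_comm _ _
      _ ≤ _ := hm2

namespace Arr

variable {E ι Ω : Type*} [Fintype ι] [DecidableEq ι]

/-- The normalizing power is the number of index pairs, so the product counts the subarrays in `B`,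
and the boxes grow. -/
theorem monotone_mul_blockFreq (B : Set (ι → ι → E)) (x : Arr E) :
    Monotone fun m : ℕ => (m : ℝ) ^ (Fintype.card ι * 2) * blockFreq (fun _ => m) B x := by
  have h : ∀ m : ℕ, (m : ℝ) ^ (Fintype.card ι * 2) * blockFreq (fun _ => m) B x =
      ∑ a ∈ indexBox (fun _ : ι => m), ∑ b ∈ indexBox (fun _ : ι => m),
        B.indicator (fun _ => (1 : ℝ)) (subarray a b x) := by
    intro m
    have hc : (m : ℝ) ^ (Fintype.card ι * 2) = ((indexBox (fun _ : ι => m)).card : ℝ) ^ 2 := by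
      rw [card_indexBox]; simp [pow_mul]
    rw [hc, blockFreq]
    by_cases h0 : indexBox (fun _ : ι => m) = ∅
    · simp [h0]
    · rw [mul_inv_cancel_left₀]
      simpa using h0
  intro m m' hmm
  simp only [h]
  have hsub : indexBox (fun _ : ι => m) ⊆ indexBox (fun _ : ι => m') := fun a ha =>
    mem_indexBox.2 fun i => (mem_indexBox.1 ha i).trans_le hmm
  have hnn : ∀ a b : ι → ℕ, 0 ≤ B.indicator (fun _ => (1 : ℝ)) (subarray a b x) := fun a b =>
    Set.indicator_nonneg (fun _ _ => zero_le_one) _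
  calc _ ≤ ∑ a ∈ indexBox (fun _ : ι => m), ∑ b ∈ indexBox (fun _ : ι => m'),
        B.indicator (fun _ => (1 : ℝ)) (subarray a b x) :=
        Finset.sum_le_sum fun a _ =>
          Finset.sum_le_sum_of_subset_of_nonneg hsub fun b _ _ => hnn a b
    _ ≤ _ := Finset.sum_le_sum_of_subset_of_nonneg hsub fun a _ _ =>
        Finset.sum_nonneg fun b _ => hnn a b

variable [MeasurableSpace E] [MeasurableSpace Ω] {P : Measure Ω} [IsProbabilityMeasure P]
  {X : Ω → Arr E}

/-- By `blockFreq_mul`, each of the three mixed moments in the expanded square is the expected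
frequency of a product event. All are within `8 * card² / k` of one common probability, that two
diagonal blocks on disjoint indices lie in `B`. The coefficients 1, -2, 1 cancel that probability
and leave four errors. -/
theorem IsExchangeable.integral_sq_blockFreq_sub_le (hX : Measurable X)
    (hexch : IsExchangeable X P) {B : Set (ι → ι → E)} (hB : MeasurableSet B) {k m : ℕ}
    (hk : 0 < k) (hkm : k ≤ m) :
    ∫ ω, (blockFreq (fun _ => k) B (X ω) - blockFreq (fun _ => m) B (X ω)) ^ 2 ∂P ≤
      32 * (Fintype.card ι : ℝ) ^ 2 / k := by
  obtain ⟨a, ha⟩ : ∃ a : ι ⊕ ι → ℕ, Function.Injective a :=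
    ⟨fun i => Fintype.equivFin (ι ⊕ ι) i,
      fun i j h => (Fintype.equivFin (ι ⊕ ι)).injective (Fin.ext h)⟩
  have hprod : ∀ p q : ℕ, k ≤ p → k ≤ q →
      |∫ ω, blockFreq (fun _ => p) B (X ω) * blockFreq (fun _ => q) B (X ω) ∂P -
        P.real (Set.univ ∩ {ω | subarray a a (X ω) ∈ blockProd B B})| ≤
          8 * (Fintype.card ι : ℝ) ^ 2 / k := by
    intro p q hp hq
    have h := hexch.abs_setIntegral_blockFreq_sub_le hX (N := Sum.elim (fun _ => p) fun _ => q)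
      hk (by rintro (i | i) <;> assumption) ha ha (measurableSet_blockProd hB hB) MeasurableSet.univ
    simp only [blockFreq_mul, Measure.restrict_univ, Fintype.card_sum] at h
    refine h.trans (le_of_eq ?_)
    push_cast
    ring
  have hi : ∀ p q : ℕ, Integrable
      (fun ω => blockFreq (fun _ => p) B (X ω) * blockFreq (fun _ => q) B (X ω)) P := by
    intro p q
    have := integrable_blockFreq (P := P) hX (Sum.elim (fun _ => p) fun _ => q)
      (measurableSet_blockProd hB hB)
    simpa only [blockFreq_mul] using this
  have hexp : ∫ ω, (blockFreq (fun _ => k) B (X ω) - blockFreq (fun _ => m) B (X ω)) ^ 2 ∂P =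
      ∫ ω, blockFreq (fun _ => k) B (X ω) * blockFreq (fun _ => k) B (X ω) ∂P -
        2 * ∫ ω, blockFreq (fun _ => k) B (X ω) * blockFreq (fun _ => m) B (X ω) ∂P +
        ∫ ω, blockFreq (fun _ => m) B (X ω) * blockFreq (fun _ => m) B (X ω) ∂P := by
    have hi' : Integrable (fun ω => blockFreq (fun _ => k) B (X ω) * blockFreq (fun _ => k) B (X ω) -
        2 * (blockFreq (fun _ => k) B (X ω) * blockFreq (fun _ => m) B (X ω))) P :=
      (hi k k).sub ((hi k m).const_mul 2)
    rw [← integral_const_mul, ← integral_sub (hi _ _) ((hi _ _).const_mul 2),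
      ← integral_add hi' (hi _ _)]
    refine integral_congr_ae (Eventually.of_forall fun ω => ?_)
    dsimp only
    ring
  have h1 := abs_le.1 (hprod k k le_rfl le_rfl)
  have h2 := abs_le.1 (hprod k m le_rfl hkm)
  have h3 := abs_le.1 (hprod m m hkm hkm)
  rw [hexp]
  have : 32 * (Fintype.card ι : ℝ) ^ 2 / k = 4 * (8 * (Fintype.card ι : ℝ) ^ 2 / k) := by ring
  linarith [h1.2, h2.1, h3.2]

/-- The frequencies of `B` among the subarrays of an exchangeable array converge. -/
theorem IsExchangeable.ae_exists_tendsto_blockFreq (hX : Measurable X)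
    (hexch : IsExchangeable X P) {B : Set (ι → ι → E)} (hB : MeasurableSet B) :
    ∀ᵐ ω ∂P, ∃ l, Tendsto (fun m : ℕ => blockFreq (fun _ => m) B (X ω)) atTop (𝓝 l) := by
  set f : ℕ → Ω → ℝ := fun j ω => blockFreq (fun _ => (j + 1) ^ 4) B (X ω) with hf
  have hfm : ∀ j, AEStronglyMeasurable (f j) P := fun j =>
    ((measurable_blockFreq _ hB).comp hX).aestronglyMeasurable
  set D : ℝ := 32 * (Fintype.card ι : ℝ) ^ 2 with hD
  have hD0 : 0 ≤ D := by positivity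
  -- The squared L² distance is O(1/side), so sides `(j + 1) ^ 4` give distances O(1/(N+1)²), which
  -- are summable. The `+ 1` after `√D` makes the inequality strict even when `D = 0`.
  have key : ∀ N n m : ℕ, N ≤ n → n ≤ m →
      eLpNorm (f n - f m) 2 P < ENNReal.ofReal ((√D + 1) * (1 / ((N : ℝ) + 1) ^ 2)) := by
    intro N n m hNn hnm
    have hmem : MemLp (f n - f m) 2 P := by
      refine MemLp.of_bound ((hfm n).sub (hfm m)) 1 (Eventually.of_forall fun ω => ?_)
      rw [Real.norm_eq_abs, abs_le, Pi.sub_apply]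
      have h1 := blockFreq_nonneg (fun _ => (n + 1) ^ 4) B (X ω)
      have h2 := blockFreq_nonneg (fun _ => (m + 1) ^ 4) B (X ω)
      have h3 := blockFreq_le_one (fun _ => (n + 1) ^ 4) B (X ω)
      have h4 := blockFreq_le_one (fun _ => (m + 1) ^ 4) B (X ω)
      simp only [hf]
      constructor <;> linarith
    rw [hmem.eLpNorm_eq_integral_rpow_norm (by norm_num) (by norm_num)]
    have hsq : ∫ ω, ‖(f n - f m) ω‖ ^ (2 : ℝ≥0∞).toReal ∂P ≤ D / ((N : ℝ) + 1) ^ 4 := by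
      have h := hexch.integral_sq_blockFreq_sub_le hX hB (k := (n + 1) ^ 4) (m := (m + 1) ^ 4)
        (by positivity) (by gcongr)
      calc ∫ ω, ‖(f n - f m) ω‖ ^ (2 : ℝ≥0∞).toReal ∂P = ∫ ω, (f n ω - f m ω) ^ 2 ∂P := by
            refine integral_congr_ae (Eventually.of_forall fun ω => ?_)
            simp
        _ ≤ D / (((n + 1) ^ 4 : ℕ) : ℝ) := h
        _ ≤ D / ((N : ℝ) + 1) ^ 4 := by
            push_cast
            gcongr
    refine (ENNReal.ofReal_lt_ofReal_iff (by positivity)).2 ?_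
    calc (∫ ω, ‖(f n - f m) ω‖ ^ (2 : ℝ≥0∞).toReal ∂P) ^ ((2 : ℝ≥0∞).toReal)⁻¹
        ≤ (D / ((N : ℝ) + 1) ^ 4) ^ ((2 : ℝ≥0∞).toReal)⁻¹ := by
          gcongr
      _ = √D * (1 / ((N : ℝ) + 1) ^ 2) := by
          rw [show ((2 : ℝ≥0∞).toReal)⁻¹ = 1 / 2 by simp, ← Real.sqrt_eq_rpow,
            Real.sqrt_div' _ (by positivity),
            show ((N : ℝ) + 1) ^ 4 = (((N : ℝ) + 1) ^ 2) ^ 2 by ring, Real.sqrt_sq (by positivity)]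
          ring
      _ < (√D + 1) * (1 / ((N : ℝ) + 1) ^ 2) := by
          gcongr
          linarith
  have hsum : Summable fun N : ℕ => (√D + 1) * (1 / ((N : ℝ) + 1) ^ 2) := by
    refine Summable.mul_left _ ?_
    have := (summable_nat_add_iff 1).2 (Real.summable_one_div_nat_pow.2 one_lt_two)
    simpa using this
  have hae := Lp.ae_tendsto_of_cauchy_eLpNorm (p := 2) hfm one_le_two hsum.tsum_ofReal_ne_top
    (fun N n m hn hm => by
      rcases le_total n m with h | h
      · exact key N n m hn h
      · rw [eLpNorm_sub_comm]
        exact key N m n hm h)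
  filter_upwards [hae] with ω ⟨l, hl⟩
  exact ⟨l, tendsto_of_tendsto_pow_four (fun m => blockFreq_nonneg _ _ _)
    (monotone_mul_blockFreq B (X ω)) hl⟩

/-- A finite permutation leaves the frequencies over all large boxes unchanged, so the limsup is an
invariant function, defined everywhere and not only where the limit exists. -/
theorem measurable_limsup_blockFreq {B : Set (ι → ι → E)} (hB : MeasurableSet B) :
    Measurable[exchangeableSets E] fun x : Arr E =>
      limsup (fun m : ℕ => blockFreq (fun _ => m) B x) atTop := by
  have hinv : ∀ π₁ π₂ : Equiv.Perm ℕ, IsFinPerm π₁ → IsFinPerm π₂ → ∀ x : Arr E,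
      limsup (fun m : ℕ => blockFreq (fun _ => m) B (permute π₁ π₂ x)) atTop =
        limsup (fun m : ℕ => blockFreq (fun _ => m) B x) atTop := fun π₁ π₂ h₁ h₂ x =>
    limsup_congr (eventually_blockFreq_permute h₁ h₂ B x)
  intro D hD
  refine ⟨hD.preimage (Measurable.limsup fun m => measurable_blockFreq _ hB),
    fun π₁ π₂ h₁ h₂ => Set.Subset.antisymm ?_ ?_⟩
  · rintro _ ⟨x, hx, rfl⟩
    rw [Set.mem_preimage, hinv π₁ π₂ h₁ h₂]
    exact hx
  · intro x hx
    refine ⟨permute π₁.symm π₂.symm x, ?_, by funext i j; simp [permute]⟩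
    rw [Set.mem_preimage, hinv _ _ h₁.symm h₂.symm]
    exact hx

/-- The limit of the frequencies of `B` is the conditional probability, given the exchangeable
σ-field, that any subarray with distinct rows and distinct columns lies in `B`. -/
theorem IsExchangeable.ae_tendsto_blockFreq (hX : Measurable X) (hexch : IsExchangeable X P)
    {α : @Kernel Ω (Arr E) (exchangeableField X) _} (hα : IsRegCondDistrib α X P)
    {a b : ι → ℕ} (ha : Function.Injective a) (hb : Function.Injective b)
    {B : Set (ι → ι → E)} (hB : MeasurableSet B) :
    ∀ᵐ ω ∂P, Tendsto (fun m : ℕ => blockFreq (fun _ => m) B (X ω)) atTop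
      (𝓝 ((α ω).real (subarray a b ⁻¹' B))) := by
  have hle := exchangeableField_le hX
  have hα1 := hα.1
  have hBm : MeasurableSet (subarray a b ⁻¹' B : Set (Arr E)) :=
    hB.preimage (measurable_subarray a b)
  have hconv := hexch.ae_exists_tendsto_blockFreq hX hB
  set G : Ω → ℝ := fun ω => limsup (fun m : ℕ => blockFreq (fun _ => m) B (X ω)) atTop with hG
  have hGlim : ∀ᵐ ω ∂P, Tendsto (fun m : ℕ => blockFreq (fun _ => m) B (X ω)) atTop (𝓝 (G ω)) := by
    filter_upwards [hconv] with ω ⟨l, hl⟩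
    rw [hG]
    dsimp only
    rwa [hl.limsup_eq]
  have hGm : Measurable[exchangeableField X] G :=
    (measurable_limsup_blockFreq hB).comp (comap_measurable X)
  have hGint : Integrable G P := by
    refine Integrable.of_bound (hGm.mono hle le_rfl).aestronglyMeasurable 1 ?_
    filter_upwards [hGlim] with ω hω
    rw [Real.norm_of_nonneg (ge_of_tendsto' hω fun m => blockFreq_nonneg _ _ _)]
    exact le_of_tendsto' hω fun m => blockFreq_le_one _ _ _
  have hαm : Measurable[exchangeableField X] fun ω => α ω (subarray a b ⁻¹' B) :=
    Kernel.measurable_coe α hBm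
  have hαint : Integrable (fun ω => (α ω).real (subarray a b ⁻¹' B)) P := by
    refine Integrable.of_bound (hαm.ennreal_toReal.mono hle le_rfl).aestronglyMeasurable 1 ?_
    refine Eventually.of_forall fun ω => ?_
    rw [Real.norm_of_nonneg measureReal_nonneg]
    exact measureReal_le_one
  -- Both sides are measurable for the exchangeable field, so equal integrals over its events
  -- suffice. For `G` these are limits of expected frequencies, by dominated convergence.
  have heq : G =ᵐ[P] fun ω => (α ω).real (subarray a b ⁻¹' B) := by
    refine ae_eq_of_forall_setIntegral_eq_of_sigmaFinite' hle (fun _ _ _ => hGint.integrableOn)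
      (fun _ _ _ => hαint.integrableOn) (fun C hC _ => ?_) hGm.aestronglyMeasurable
      hαm.ennreal_toReal.aestronglyMeasurable
    have h1 : ∫ ω in C, (α ω).real (subarray a b ⁻¹' B) ∂P =
        P.real (C ∩ {ω | subarray a b (X ω) ∈ B}) := by
      have := hα.2 _ hBm C hC
      simp only [Measure.real]
      rw [integral_toReal (hαm.mono hle le_rfl).aemeasurable
        (Eventually.of_forall fun ω => measure_lt_top _ _), this]
      rfl
    have h2 : Tendsto (fun m : ℕ => ∫ ω in C, blockFreq (fun _ => m) B (X ω) ∂P) atTop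
        (𝓝 (∫ ω in C, G ω ∂P)) := by
      refine tendsto_integral_of_dominated_convergence (fun _ => 1)
        (fun m => ((measurable_blockFreq _ hB).comp hX).aestronglyMeasurable)
        (integrable_const _) (fun m => Eventually.of_forall fun ω => ?_)
        (ae_restrict_of_ae hGlim)
      rw [Real.norm_of_nonneg (blockFreq_nonneg _ _ _)]
      exact blockFreq_le_one _ _ _
    have h3 : Tendsto (fun m : ℕ => ∫ ω in C, blockFreq (fun _ => m) B (X ω) ∂P) atTop
        (𝓝 (P.real (C ∩ {ω | subarray a b (X ω) ∈ B}))) := by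
      rw [tendsto_iff_dist_tendsto_zero]
      refine squeeze_zero' (Eventually.of_forall fun m => dist_nonneg) ?_
        (tendsto_const_div_atTop_nhds_zero_nat (2 * (Fintype.card ι : ℝ) ^ 2))
      filter_upwards [eventually_gt_atTop 0] with m hm
      rw [Real.dist_eq]
      exact hexch.abs_setIntegral_blockFreq_sub_le hX hm (fun _ => le_rfl) ha hb hB hC
    rw [h1]
    exact tendsto_nhds_unique h2 h3
  filter_upwards [hGlim, heq] with ω h1 h2
  rwa [← h2]

end Arr

/-! ### Weak convergence tested on a countable algebra -/

/-- A countable algebra of sets that contains a basis of the topology. -/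
def basisAlgebra (Z : Type*) [TopologicalSpace Z] [SecondCountableTopology Z] : Set (Set Z) :=
  generateSetAlgebra (TopologicalSpace.countableBasis Z)

section basisAlgebra

variable (Z : Type*) [TopologicalSpace Z] [SecondCountableTopology Z]

theorem countable_basisAlgebra : (basisAlgebra Z).Countable :=
  countable_generateSetAlgebra (TopologicalSpace.countable_countableBasis Z)

theorem isPiSystem_basisAlgebra : IsPiSystem (basisAlgebra Z) := fun _ hA _ hB _ =>
  isSetAlgebra_generateSetAlgebra.inter_mem hA hB

theorem generateFrom_basisAlgebra [MeasurableSpace Z] [BorelSpace Z] :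
    MeasurableSpace.generateFrom (basisAlgebra Z) = ‹MeasurableSpace Z› := by
  rw [basisAlgebra, generateFrom_generateSetAlgebra_eq, BorelSpace.measurable_eq (α := Z),
    (TopologicalSpace.isBasis_countableBasis Z).borel_eq_generateFrom]

variable {Z}

theorem measurableSet_of_mem_basisAlgebra [MeasurableSpace Z] [BorelSpace Z] {A : Set Z}
    (hA : A ∈ basisAlgebra Z) : MeasurableSet A := by
  rw [← generateFrom_basisAlgebra Z]
  exact MeasurableSpace.measurableSet_generateFrom hA

/-- The algebra is a π-system containing arbitrarily small neighbourhoods of each point, which is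
enough for weak convergence. Countability is what lets almost sure convergence hold for all test
sets at once. -/
theorem tendsto_probabilityMeasure_of_basisAlgebra [MeasurableSpace Z] [BorelSpace Z]
    {μ : ℕ → ProbabilityMeasure Z} {ν : ProbabilityMeasure Z}
    (h : ∀ A ∈ basisAlgebra Z, Tendsto (fun i => (μ i : Measure Z).real A) atTop
      (𝓝 ((ν : Measure Z).real A))) : Tendsto μ atTop (𝓝 ν) := by
  refine (isPiSystem_basisAlgebra Z).tendsto_probabilityMeasure_of_tendsto_of_mem
    (fun A hA => measurableSet_of_mem_basisAlgebra hA) (fun u hu x hx => ?_) fun A hA => ?_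
  · obtain ⟨v, hv, hxv, hvu⟩ :=
      (TopologicalSpace.isBasis_countableBasis Z).exists_subset_of_mem_open hx hu
    exact ⟨v, self_subset_generateSetAlgebra hv,
      ((TopologicalSpace.isBasis_countableBasis Z).isOpen hv).mem_nhds hxv, hvu⟩
  · rw [← NNReal.tendsto_coe]
    exact h A hA

end basisAlgebra

/-! ### From block frequencies to the law `|y|` -/

namespace Arr

theorem measurable_restrict {S : Type*} [MeasurableSpace S] (n : ℕ) :
    Measurable (restrict (S := S) n) := by
  unfold restrict; fun_prop

theorem monotone_comap_restrict (S : Type*) [MeasurableSpace S] :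
    Monotone fun n : ℕ => MeasurableSpace.comap (restrict (S := S) n) inferInstance := by
  intro n m hnm
  have h : restrict (S := S) n =
      (fun z i j => z (Fin.castLE hnm i) (Fin.castLE hnm j)) ∘ restrict m := rfl
  dsimp only
  rw [h, ← MeasurableSpace.comap_comp]
  refine MeasurableSpace.comap_mono (Measurable.comap_le ?_)
  fun_prop

theorem iSup_comap_restrict (S : Type*) [MeasurableSpace S] :
    ⨆ n : ℕ, MeasurableSpace.comap (restrict (S := S) n) inferInstance =
      (inferInstance : MeasurableSpace (Arr S)) := by
  refine le_antisymm (iSup_le fun n => (measurable_restrict n).comap_le) ?_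
  refine iSup_le fun i => ?_
  rw [MeasurableSpace.pi, MeasurableSpace.comap_iSup]
  refine iSup_le fun j => ?_
  rw [MeasurableSpace.comap_comp]
  refine le_trans ?_ (le_iSup _ (max i j + 1))
  have h : (fun y : Arr S => y i j) =
      (fun z => z ⟨i, by omega⟩ ⟨j, by omega⟩) ∘ restrict (max i j + 1) := rfl
  change MeasurableSpace.comap (fun y : Arr S => y i j) _ ≤ _
  rw [h, ← MeasurableSpace.comap_comp]
  refine MeasurableSpace.comap_mono (Measurable.comap_le ?_)
  fun_prop

/-- A law on arrays is determined by its restrictions to finite blocks. -/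
theorem ext_of_restrict {S : Type*} [MeasurableSpace S] {μ ν : Measure (Arr S)}
    [IsProbabilityMeasure μ] [IsProbabilityMeasure ν]
    (h : ∀ n : ℕ, μ.map (restrict n) = ν.map (restrict n)) : μ = ν := by
  refine ext_of_generate_finite
    (⋃ n : ℕ, {s | MeasurableSet[MeasurableSpace.comap (restrict (S := S) n) inferInstance] s})
    ?_ ?_ ?_ (by simp)
  · exact ((MeasurableSpace.generateFrom_iUnion_measurableSet fun n : ℕ =>
      MeasurableSpace.comap (restrict (S := S) n) inferInstance).trans (iSup_comap_restrict S)).symm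
  · exact isPiSystem_iUnion_of_monotone _
      (fun n => @MeasurableSpace.isPiSystem_measurableSet _
        (MeasurableSpace.comap (restrict (S := S) n) inferInstance))
      fun n m hnm s hs => monotone_comap_restrict S hnm s hs
  · intro s hs
    obtain ⟨n, B, hB, rfl⟩ := Set.mem_iUnion.1 hs
    rw [← Measure.map_apply (measurable_restrict n) hB, h n,
      Measure.map_apply (measurable_restrict n) hB]

theorem sum_embedding_eq_sum_indexBox {M : Type*} [AddCommMonoid M] (n m : ℕ)
    (f : (Fin n → ℕ) → M) :
    ∑ ψ : Fin n ↪ Fin m, f (fun i => ψ i) =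
      ∑ a ∈ (indexBox fun _ : Fin n => m).filter Function.Injective, f a := by
  refine Finset.sum_bij (fun ψ _ i => (ψ i : ℕ)) ?_ ?_ ?_ ?_
  · intro ψ _
    exact Finset.mem_filter.2 ⟨mem_indexBox.2 fun i => (ψ i).2,
      fun i j h => ψ.injective (Fin.ext h)⟩
  · intro ψ _ χ _ h
    ext i
    exact congrFun h i
  · intro a ha
    obtain ⟨h1, h2⟩ := Finset.mem_filter.1 ha
    exact ⟨⟨fun i => ⟨a i, mem_indexBox.1 h1 i⟩, fun i j h => h2 (Fin.mk.inj_iff.1 h)⟩,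
      Finset.mem_univ _, rfl⟩
  · intros; rfl

theorem empirical_real {S : Type*} [MeasurableSpace S] (y : Arr S) (n m : ℕ)
    {B : Set (Fin n → Fin n → S)} (hB : MeasurableSet B) :
    (empirical y n m : Measure (Fin n → Fin n → S)).real B = ((m.descFactorial n : ℝ) ^ 2)⁻¹ *
      ∑ a ∈ (indexBox fun _ : Fin n => m).filter Function.Injective,
        ∑ b ∈ (indexBox fun _ : Fin n => m).filter Function.Injective,
          B.indicator (fun _ => (1 : ℝ)) (subarray a b y) := by
  rw [← sum_embedding_eq_sum_indexBox]
  simp only [← sum_embedding_eq_sum_indexBox]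
  have h : ∀ z : Fin n → Fin n → S, (((diracProba z).toFiniteMeasure B : ℝ≥0) : ℝ) =
      B.indicator (fun _ => (1 : ℝ)) z := by
    intro z
    change ((diracProba z : Measure _) B).toReal = _
    rw [diracProba_toMeasure_apply' z hB]
    by_cases hz : z ∈ B <;> simp [hz]
  change ((empirical y n m B : ℝ≥0) : ℝ) = _
  have hsum : ∀ ν : (Fin n ↪ Fin m) → FiniteMeasure (Fin n → Fin n → S),
      (∑ ψ, ν ψ) B = ∑ ψ, ν ψ B := fun ν =>
    map_sum (⟨⟨fun μ : FiniteMeasure (Fin n → Fin n → S) => μ B, by simp⟩, by simp⟩ :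
      FiniteMeasure (Fin n → Fin n → S) →+ ℝ≥0) ν Finset.univ
  rw [empirical, FiniteMeasure.smul_apply, smul_eq_mul]
  simp only [hsum]
  push_cast
  simp only [h]
  rfl

theorem card_filter_injective_indexBox (n m : ℕ) :
    ((indexBox fun _ : Fin n => m).filter Function.Injective).card = m.descFactorial n := by
  have := sum_embedding_eq_sum_indexBox n m fun _ => 1
  simpa [Fintype.card_embedding_eq] using this.symm

theorem isProbabilityMeasure_empirical {S : Type*} [MeasurableSpace S] (y : Arr S) {n m : ℕ}
    (hnm : n ≤ m) : IsProbabilityMeasure (empirical y n m : Measure (Fin n → Fin n → S)) := by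
  have hpos : (m.descFactorial n : ℝ) ≠ 0 := by
    exact_mod_cast mt Nat.descFactorial_eq_zero_iff_lt.1 hnm.not_gt
  have h := empirical_real y n m MeasurableSet.univ
  simp only [Set.indicator_univ, Finset.sum_const, card_filter_injective_indexBox, nsmul_eq_mul,
    mul_one] at h
  rw [← sq, inv_mul_cancel₀ (pow_ne_zero 2 hpos)] at h
  exact ⟨by rwa [Measure.real, ENNReal.toReal_eq_one_iff] at h⟩

/-- The empirical distribution is the same average restricted to injective tuples, so
`abs_average_sub_le` applies with its value on `B` as the constant. -/
theorem abs_blockFreq_sub_empirical_le {S : Type*} [MeasurableSpace S] (y : Arr S) {n m : ℕ}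
    (hnm : n ≤ m) (hm : 0 < m) {B : Set (Fin n → Fin n → S)} (hB : MeasurableSet B) :
    |blockFreq (fun _ => m) B y - (empirical y n m : Measure (Fin n → Fin n → S)).real B| ≤
      2 * (n : ℝ) ^ 2 / m := by
  have hprob := isProbabilityMeasure_empirical y hnm
  have hpos : (m.descFactorial n : ℝ) ≠ 0 := by
    exact_mod_cast mt Nat.descFactorial_eq_zero_iff_lt.1 hnm.not_gt
  have hne := indexBox_nonempty (N := fun _ : Fin n => m) hm fun _ => le_rfl
  refine (abs_average_sub_le _ Function.Injective
    (fun a b => B.indicator (fun _ => (1 : ℝ)) (subarray a b y)) _ hne ?_ ?_).trans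
    ((two_mul_card_not_injective_div_le hm fun _ => le_rfl).trans_eq (by simp))
  · simp only [Finset.sum_sub_distrib, Finset.sum_const, card_filter_injective_indexBox,
      nsmul_eq_mul]
    rw [empirical_real y n m hB]
    field_simp
    ring
  · intro a b
    have h1 := measureReal_nonneg (μ := (empirical y n m : Measure (Fin n → Fin n → S))) (s := B)
    have h2 := measureReal_le_one (μ := (empirical y n m : Measure (Fin n → Fin n → S))) (s := B)
    have h3 : 0 ≤ B.indicator (fun _ => (1 : ℝ)) (subarray a b y) :=
      Set.indicator_nonneg (fun _ _ => zero_le_one) _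
    have h4 : B.indicator (fun _ => (1 : ℝ)) (subarray a b y) ≤ 1 :=
      Set.indicator_le_self' (fun _ _ => zero_le_one) _
    rw [abs_le]
    constructor <;> linarith

theorem tendsto_empirical_real {S : Type*} [MeasurableSpace S] {y : Arr S} {n : ℕ}
    {B : Set (Fin n → Fin n → S)} (hB : MeasurableSet B) {l : ℝ}
    (h : Tendsto (fun m : ℕ => blockFreq (fun _ => m) B y) atTop (𝓝 l)) :
    Tendsto (fun m => (empirical y n m : Measure (Fin n → Fin n → S)).real B) atTop (𝓝 l) := by
  have h0 : Tendsto (fun m => blockFreq (fun _ => m) B y -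
      (empirical y n m : Measure (Fin n → Fin n → S)).real B) atTop (𝓝 0) := by
    rw [tendsto_zero_iff_abs_tendsto_zero]
    refine squeeze_zero' (Eventually.of_forall fun m => abs_nonneg _) ?_
      (tendsto_const_div_atTop_nhds_zero_nat (2 * (n : ℝ) ^ 2))
    filter_upwards [eventually_gt_atTop 0, eventually_ge_atTop n] with m hm hnm
    exact abs_blockFreq_sub_empirical_le y hnm hm hB
  simpa using h.sub h0

section

variable {S : Type*} [TopologicalSpace S] [PolishSpace S] [MeasurableSpace S] [BorelSpace S]

theorem hasLimitLaw_of_tendsto_blockFreq {y : Arr S} {ν : ProbabilityMeasure (Arr S)}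
    (h : ∀ n : ℕ, ∀ B ∈ basisAlgebra (Fin n → Fin n → S),
      Tendsto (fun m : ℕ => blockFreq (fun _ => m) B y) atTop
        (𝓝 ((ν : Measure (Arr S)).real (restrict n ⁻¹' B)))) : HasLimitLaw y ν := by
  intro n
  have hmeas := (measurable_restrict (S := S) n).aemeasurable (μ := (ν : Measure (Arr S)))
  -- The shift by `n` discards the indices where the empirical distribution may fail to be a
  -- probability measure.
  set μ : ℕ → ProbabilityMeasure (Fin n → Fin n → S) := fun m =>
    ⟨empirical y n (m + n), isProbabilityMeasure_empirical y (Nat.le_add_left n m)⟩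
  have hμ : Tendsto μ atTop (𝓝 (ν.map hmeas)) := by
    refine tendsto_probabilityMeasure_of_basisAlgebra fun B hB => ?_
    have hBm := measurableSet_of_mem_basisAlgebra hB
    have h1 := (tendsto_add_atTop_iff_nat n).2 (tendsto_empirical_real hBm (h n B hB))
    have h2 : ((ν.map hmeas : ProbabilityMeasure _) : Measure (Fin n → Fin n → S)).real B =
        (ν : Measure (Arr S)).real (restrict n ⁻¹' B) := by
      rw [Measure.real, Measure.real, ProbabilityMeasure.toMeasure_map,
        Measure.map_apply (measurable_restrict n) hBm]
    rw [h2]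
    exact h1
  rw [ProbabilityMeasure.tendsto_nhds_iff_toFiniteMeasure_tendsto_nhds] at hμ
  exact (tendsto_add_atTop_iff_nat n).1 hμ

theorem HasLimitLaw.unique {y : Arr S} {ν ν' : ProbabilityMeasure (Arr S)} (h : HasLimitLaw y ν)
    (h' : HasLimitLaw y ν') : ν = ν' := by
  have key : (ν : Measure (Arr S)) = ν' := ext_of_restrict fun n =>
    congrArg (fun μ : FiniteMeasure (Fin n → Fin n → S) => (μ : Measure (Fin n → Fin n → S)))
      (tendsto_nhds_unique (h n) (h' n))
  exact Subtype.ext key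

theorem proj_eq_some {y : Arr S} {ν : ProbabilityMeasure (Arr S)} (hν : ν ∈ dissociatedLaws S)
    (h : HasLimitLaw y ν) : proj y = some ν := by
  have hex : ∃ ν ∈ dissociatedLaws S, HasLimitLaw y ν := ⟨ν, hν, h⟩
  rw [proj, dif_pos hex, hex.choose_spec.2.unique h]

/-- The frequency does not mention `a` and `b`, so all blocks on distinct rows and distinct columns
have the same law, in particular a corner and its permuted version. -/
theorem isExchangeable_of_tendsto_blockFreq {y : Arr S} {ν : Measure (Arr S)}
    [IsProbabilityMeasure ν]
    (h : ∀ n : ℕ, ∀ a b : Fin n → ℕ, Function.Injective a → Function.Injective b →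
      ∀ B ∈ basisAlgebra (Fin n → Fin n → S),
        Tendsto (fun m : ℕ => blockFreq (fun _ => m) B y) atTop
          (𝓝 (ν.real (subarray a b ⁻¹' B)))) : IsExchangeable id ν := by
  intro π₁ π₂ _ _
  have hp : Measurable fun y : Arr S => permute π₁ π₂ (id y) := measurable_permute π₁ π₂
  have := Measure.isProbabilityMeasure_map (μ := ν) hp.aemeasurable
  rw [Measure.map_id]
  refine ext_of_restrict fun n => ?_
  have hr := measurable_restrict (S := S) n
  have hp1 := Measure.isProbabilityMeasure_map (μ := ν) hr.aemeasurable
  have hp2 := Measure.isProbabilityMeasure_map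
    (μ := ν.map fun y : Arr S => permute π₁ π₂ (id y)) hr.aemeasurable
  refine ext_of_generate_finite _ (generateFrom_basisAlgebra (Fin n → Fin n → S)).symm
    (isPiSystem_basisAlgebra _) (fun B hB => ?_) (by rw [measure_univ, measure_univ])
  have hBm := measurableSet_of_mem_basisAlgebra hB
  rw [Measure.map_apply hr hBm, Measure.map_apply hr hBm, Measure.map_apply hp (hr hBm)]
  have h1 := h n (fun i => π₁ i) (fun i => π₂ i) (π₁.injective.comp Fin.val_injective)
    (π₂.injective.comp Fin.val_injective) B hB
  have h2 := h n (fun i => i) (fun i => i) Fin.val_injective Fin.val_injective B hB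
  exact (measureReal_eq_measureReal_iff).1 (tendsto_nhds_unique h1 h2)

/-- The π-systems extend the product rule to independence of finite corners. The corners of the
shifted array generate an increasing family of σ-fields whose supremum is the field of the whole
shifted array. -/
theorem isDissociated_of_measure_inter {ν : Measure (Arr S)} [IsProbabilityMeasure ν]
    (h : ∀ n k : ℕ, ∀ A ∈ basisAlgebra (Fin n → Fin n → S),
      ∀ B ∈ basisAlgebra (Fin k → Fin k → S),
        ν (restrict n ⁻¹' A ∩ subarray (fun i : Fin k => n + i) (fun i : Fin k => n + i) ⁻¹' B) =
          ν (restrict n ⁻¹' A) *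
            ν (subarray (fun i : Fin k => n + i) (fun i : Fin k => n + i) ⁻¹' B)) :
    IsDissociated ν := by
  intro n
  set V : Arr S → Arr S := fun y i j => y (n + i) (n + j) with hV
  have hVm : Measurable V := by fun_prop
  have hr := measurable_restrict (S := S) n
  have hfin : ∀ k : ℕ, Indep
      (((inferInstance : MeasurableSpace (Fin k → Fin k → S)).comap (restrict k)).comap V)
      ((inferInstance : MeasurableSpace (Fin n → Fin n → S)).comap (restrict n)) ν := by
    intro k
    rw [MeasurableSpace.comap_comp]
    refine Indep.symm (IndepSets.indep hr.comap_le ((measurable_restrict k).comp hVm).comap_le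
      ((isPiSystem_basisAlgebra (Fin n → Fin n → S)).comap (restrict n))
      ((isPiSystem_basisAlgebra (Fin k → Fin k → S)).comap (restrict k ∘ V)) ?_ ?_ ?_)
    · conv_lhs => rw [← generateFrom_basisAlgebra (Fin n → Fin n → S)]
      exact MeasurableSpace.comap_generateFrom
    · conv_lhs => rw [← generateFrom_basisAlgebra (Fin k → Fin k → S)]
      exact MeasurableSpace.comap_generateFrom
    · rw [IndepSets_iff]
      rintro _ _ ⟨A, hA, rfl⟩ ⟨B, hB, rfl⟩
      exact h n k A hA B hB
  have hsup := indep_iSup_of_directed_le hfin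
    (fun k => (MeasurableSpace.comap_mono (measurable_restrict k).comap_le).trans hVm.comap_le)
    hr.comap_le (Monotone.directed_le fun k k' hk =>
      MeasurableSpace.comap_mono (monotone_comap_restrict S hk))
  rw [← MeasurableSpace.comap_iSup, iSup_comap_restrict] at hsup
  exact hsup.symm

/-! ### Images of the conditional law, and the conclusion -/

/-- The image of a conditional law of an exchangeable array given its exchangeable σ-field under an
entrywise measurable map is a.s. the law `|y|` of the array `y` of the images of the entries. -/
theorem IsExchangeable.ae_proj_eq_some {E Ω : Type*} [MeasurableSpace E] [MeasurableSpace Ω]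
    {P : Measure Ω} [IsProbabilityMeasure P] {X : Ω → Arr E} (hX : Measurable X)
    (hexch : IsExchangeable X P) {α : @Kernel Ω (Arr E) (exchangeableField X) _}
    (hα : IsRegCondDistrib α X P) {f : E → S} (hf : Measurable f) :
    ∀ᵐ ω ∂P, ∃ ν : ProbabilityMeasure (Arr S), proj (fun i j => f (X ω i j)) = some ν ∧
      (α ω).map (fun x i j => f (x i j)) = (ν : Measure (Arr S)) := by
  have hF : Measurable fun (x : Arr E) i j => f (x i j) := by fun_prop
  have hα1 := hα.1
  -- The index type is left general because it is needed both for `Fin n` and for the sum `Fin n ⊕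
  -- Fin k` of two diagonal blocks.
  have hlim : ∀ {ι : Type} [Fintype ι] [DecidableEq ι] (a b : ι → ℕ), Function.Injective a →
      Function.Injective b → ∀ B : Set (ι → ι → S), MeasurableSet B →
      ∀ᵐ ω ∂P, Tendsto (fun m : ℕ => blockFreq (fun _ => m) B (fun i j => f (X ω i j))) atTop
        (𝓝 (((α ω).map fun x i j => f (x i j)).real (subarray a b ⁻¹' B))) := by
    intro ι _ _ a b ha hb B hB
    have hB' : MeasurableSet ((fun (z : ι → ι → E) i j => f (z i j)) ⁻¹' B) :=
      hB.preimage (by fun_prop)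
    filter_upwards [hexch.ae_tendsto_blockFreq hX hα ha hb hB'] with ω hω
    rw [Measure.real, Measure.map_apply hF (hB.preimage (measurable_subarray a b))]
    exact hω
  have hblock : ∀ᵐ ω ∂P, ∀ n : ℕ, ∀ a b : Fin n → ℕ, Function.Injective a →
      Function.Injective b → ∀ B ∈ basisAlgebra (Fin n → Fin n → S),
        Tendsto (fun m : ℕ => blockFreq (fun _ => m) B (fun i j => f (X ω i j))) atTop
          (𝓝 (((α ω).map fun x i j => f (x i j)).real (subarray a b ⁻¹' B))) := by
    simp only [ae_all_iff, ae_ball_iff (countable_basisAlgebra _)]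
    exact fun n a b ha hb B hB => hlim a b ha hb B (measurableSet_of_mem_basisAlgebra hB)
  have hpair : ∀ᵐ ω ∂P, ∀ n k : ℕ, ∀ A ∈ basisAlgebra (Fin n → Fin n → S),
      ∀ B ∈ basisAlgebra (Fin k → Fin k → S),
        Tendsto (fun m : ℕ => blockFreq (fun _ => m) (blockProd A B) (fun i j => f (X ω i j))) atTop
          (𝓝 (((α ω).map fun x i j => f (x i j)).real
            (restrict n ⁻¹' A ∩
              subarray (fun i : Fin k => n + i) (fun i : Fin k => n + i) ⁻¹' B))) := by
    simp only [ae_all_iff, ae_ball_iff (countable_basisAlgebra _)]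
    intro n k A hA B hB
    have hinj : Function.Injective
        (Sum.elim (fun i : Fin n => (i : ℕ)) fun i : Fin k => n + (i : ℕ)) := by
      refine Function.Injective.sumElim Fin.val_injective
        (fun i j h => Fin.ext (Nat.add_left_cancel h)) fun i j => ?_
      omega
    exact hlim _ _ hinj hinj _ (measurableSet_blockProd (measurableSet_of_mem_basisAlgebra hA)
      (measurableSet_of_mem_basisAlgebra hB))
  filter_upwards [hblock, hpair] with ω hω hω'
  have hprob := Measure.isProbabilityMeasure_map (μ := α ω) hF.aemeasurable
  have hdiss : IsDissociated ((α ω).map fun x i j => f (x i j)) := by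
    refine isDissociated_of_measure_inter fun n k A hA B hB => ?_
    have h1 := hω n _ _ Fin.val_injective Fin.val_injective A hA
    have hinj : Function.Injective fun i : Fin k => n + (i : ℕ) :=
      fun i j h => Fin.ext (Nat.add_left_cancel h)
    have h2 := hω k _ _ hinj hinj B hB
    have h3 := hω' n k A hA B hB
    -- Frequencies factorize for each `m`; in the limit this is the product rule for the two
    -- diagonal blocks under the image law.
    have h4 : ∀ m : ℕ, blockFreq (fun _ => m) (blockProd A B) (fun i j => f (X ω i j)) =
        blockFreq (fun _ => m) A (fun i j => f (X ω i j)) *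
          blockFreq (fun _ => m) B (fun i j => f (X ω i j)) := fun m => by
      rw [← blockFreq_mul]
      congr 1
      funext i
      cases i <;> rfl
    simp only [h4] at h3
    have h5 := tendsto_nhds_unique h3 (h1.mul h2)
    rw [← ENNReal.toReal_eq_toReal_iff' (measure_ne_top _ _)
      (ENNReal.mul_ne_top (measure_ne_top _ _) (measure_ne_top _ _)), ENNReal.toReal_mul]
    exact h5
  have hexc := isExchangeable_of_tendsto_blockFreq hω
  exact ⟨⟨_, hprob⟩, proj_eq_some ⟨hexc, hdiss⟩
    (hasLimitLaw_of_tendsto_blockFreq fun n B hB =>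
      hω n _ _ Fin.val_injective Fin.val_injective B hB), rfl⟩

end

end Arr

theorem lemmal {S : Type*} [MetricSpace S] [PolishSpace S] [MeasurableSpace S] [BorelSpace S]
    (T : Set ℝ) (hT : T = Set.range (fun n : ℕ => (n : ℝ)) ∨ T = Set.Ici 0)
    {Ω : Type*} [MeasurableSpace Ω] (P : Measure Ω) [IsProbabilityMeasure P]
    (X : Ω → Arr (CadlagPath T S)) (hX : Measurable X) (hexch : Arr.IsExchangeable X P) (t : T) :
    Arr.exchangeableField (fun ω => CadlagPath.evalArr t (X ω)) ≤ Arr.exchangeableField X ∧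
    ∀ α : @Kernel Ω (Arr (CadlagPath T S)) (Arr.exchangeableField X) _,
      IsRegCondDistrib α X P →
        ∀ᵐ ω ∂P, ∃ ν : ProbabilityMeasure (Arr S),
          Arr.proj (CadlagPath.evalArr t (X ω)) = some ν ∧
            (α ω).map (CadlagPath.evalArr t) = (ν : Measure (Arr S)) := by
  have ht := CadlagPath.measurable_eval (S := S) hT t
  refine ⟨?_, fun α hα => ?_⟩
  · rintro _ ⟨A, hA, rfl⟩
    refine ⟨CadlagPath.evalArr t ⁻¹' A, ⟨hA.1.preimage ?_, fun π₁ π₂ h₁ h₂ => ?_⟩, rfl⟩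
    · unfold CadlagPath.evalArr; fun_prop
    · ext x
      constructor
      · rintro ⟨z, hz, rfl⟩
        change Arr.permute π₁ π₂ (CadlagPath.evalArr t z) ∈ A
        rw [← hA.2 π₁ π₂ h₁ h₂]
        exact ⟨_, hz, rfl⟩
      · intro hx
        refine ⟨Arr.permute π₁.symm π₂.symm x, ?_, by funext i j; simp [Arr.permute]⟩
        change Arr.permute π₁.symm π₂.symm (CadlagPath.evalArr t x) ∈ A
        rw [← hA.2 π₁.symm π₂.symm h₁.symm h₂.symm]
        exact ⟨_, hx, rfl⟩
  · have h := Arr.IsExchangeable.ae_proj_eq_some (S := S) (α := α) hX hexch hα ht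
    filter_upwards [h] with ω ⟨ν, hν, hν'⟩
    exact ⟨ν, hν, hν'⟩
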